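/- Let $k$ be an algebraically closed field of characteristic $0$, let $V$ be a nonsingular variety over $k$ (a smooth separated $k$-scheme of finite type), let $E$ be a vector bundle of rank $r+1$ on $V$ $(r\ge 0)$ with a section $s$, and let $X=Z(s)\subseteq V$ be the zero-scheme of $s$; that is, writing $\mathscr E$ for the sheaf of sections of $E^\vee$, the image of the evaluation morphism $s^\vee:\mathscr E\to\mathscr O_V$ is the ideal sheaf $\mathscr I_X$ of $X$. Let $\pi:\mathscr V=\mathbb P(E^\vee)\to V$ be the projective bundle of lines in $E^\vee$, let $\mathscr O(-1)\subseteq \pi^*E^\vee$ be its tautological line subbundle, and let $\rho:\mathbb P(E^\vee|_X)=\pi^{-1}(X)\to X$ be the restriction of $\pi$. Let $\phi:E^\vee|_X\to T^*V|_X$ be the morphism corresponding to the composition $\mathscr E|_X\to\mathscr I_X/\mathscr I_X^2\to\Omega_V|_X$ of the morphism induced by $s^\vee$ and the morphism $f\mapsto df$, and let $\mathscr Y\subseteq\mathbb P(E^\vee|_X)\subseteq\mathscr V$ be the zero-scheme of the composition $$\sigma_{\mathscr Y}:\ \mathscr O(-1)\to\rho^*E^\vee|_X\xrightarrow{\ \rho^*\phi\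 }\rho^*T^*V|_X .$$ Let $\epsilon:\pi^*E\to\mathscr O(1)$ be the dual of the inclusion $\mathscr O(-1)\subseteq\pi^*E^\vee$, and let $\mathscr X\subseteq\mathscr V$ be the zero-scheme of the section $\epsilon\circ\pi^*s$ of $\mathscr O(1)$. The singularity (Jacobian) subscheme of $\mathscr X$ is the largest closed subscheme of $\mathscr X$ on which the morphism $\mathscr I_{\mathscr X}/\mathscr I_{\mathscr X}^2\to\Omega_{\mathscr V}|_{\mathscr X}$, $f\mapsto df$, vanishes. Then: 1. $\mathscr Y$ is the singularity subscheme of $\mathscr X$; that is, the two coincide as closed subschemes of $\mathscr V$. 2. Let $U\subseteq V$ be an affine open subset over which $E$ is trivial, let $y_0,\dots,y_r$ be a frame of $E|_U$ (so that $y_0,\dots,y_r$ are homogeneous coordinates on the fibers of $\pi$ over $U$), and write $s|_U=\sum_j f_jy_j$ with $f_j\in\mathscr O_V(U)$. Then $\mathscr X$ is given over $U$ by the equation $\sum_j y_jf_j=0$; that is, for every $i$, the ideal of $\mathscr X$ in the affine chart $\{y_i\neq 0\}$ of $\pi^{-1}(U)$ is generated by $\sum_j f_j\,y_j/y_i$.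 -/

import Mathlib

open AlgebraicGeometry CategoryTheory Limits TensorProduct

universe u

namespace ProjBundle

section Algebra

variable (A : Type u) [CommRing A] (N : Type u) [AddCommGroup N] [Module A N]

/-- The degree `d` part of the symmetric algebra of `N`. -/
noncomputable def gr (d : ℕ) : Submodule A (SymmetricAlgebra A N) :=
  LinearMap.range (SymmetricAlgebra.ι A N) ^ d

theorem iota_mem (l : N) : SymmetricAlgebra.ι A N l ∈ gr A N 1 := by
  simp [gr]

noncomputable instance gr_gradedMonoid : SetLike.GradedMonoid (gr A N) where
  one_mem := by
    change (1 : SymmetricAlgebra A N) ∈ LinearMap.range (SymmetricAlgebra.ι A N) ^ 0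
    rw [pow_zero]
    exact Submodule.one_le.mp le_rfl
  mul_mem i j x y hx hy := by
    change _ ∈ LinearMap.range (SymmetricAlgebra.ι A N) ^ (i + j)
    rw [pow_add]
    exact Submodule.mul_mem_mul hx hy

noncomputable instance gr_gradedAlgebra : GradedAlgebra (gr A N) :=
  GradedAlgebra.ofAlgHom (gr A N)
    (SymmetricAlgebra.lift (DirectSum.lof A ℕ (fun i ↦ gr A N i) 1 ∘ₗ
      (SymmetricAlgebra.ι A N).codRestrict (gr A N 1) (iota_mem A N)))
    (by
      apply SymmetricAlgebra.algHom_ext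
      ext m
      change DirectSum.coeAlgHom (gr A N) (SymmetricAlgebra.lift _ (SymmetricAlgebra.ι A N m)) = _
      rw [SymmetricAlgebra.lift_ι_apply]
      simp only [LinearMap.comp_apply]
      erw [DirectSum.coeAlgHom_of]
      rfl)
    (fun i x ↦ by
      obtain ⟨x, hx⟩ := x
      dsimp only
      change x ∈ LinearMap.range (SymmetricAlgebra.ι A N) ^ i at hx
      induction hx using Submodule.pow_induction_on_left' with
      | algebraMap r => rw [AlgHom.commutes, DirectSum.algebraMap_apply]; rfl
      | add x y i hx hy ihx ihy =>
        rw [map_add, ihx, ihy, ← map_add]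
        rfl
      | mem_mul m hm i x hx ih =>
        obtain ⟨m, rfl⟩ := hm
        rw [map_mul, ih, SymmetricAlgebra.lift_ι_apply]
        simp only [LinearMap.comp_apply]
        erw [DirectSum.of_mul_of]
        exact DirectSum.of_eq_of_gradedMonoid_eq (Sigma.subtype_ext (add_comm _ _) rfl))

variable {A N}
variable {A' : Type u} [CommRing A'] {N' : Type u} [AddCommGroup N'] [Module A' N']

theorem ringHom_ext {R : Type*} [CommRing R] {F G : SymmetricAlgebra A N →+* R}
    (h₀ : ∀ a, F (algebraMap A _ a) = G (algebraMap A _ a))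
    (h₁ : ∀ n, F (SymmetricAlgebra.ι A N n) = G (SymmetricAlgebra.ι A N n)) : F = G := by
  refine RingHom.ext fun x ↦ ?_
  induction x using SymmetricAlgebra.induction with
  | algebraMap r => exact h₀ r
  | ι x => exact h₁ x
  | mul x y hx hy => rw [map_mul, map_mul, hx, hy]
  | add x y hx hy => rw [map_add, map_add, hx, hy]

/-- The ring homomorphism of symmetric algebras induced by a semilinear map. -/
noncomputable def symMap {σ : A' →+* A} (g : N' →ₛₗ[σ] N) :
    SymmetricAlgebra A' N' →+* SymmetricAlgebra A N :=
  letI : Algebra A' (SymmetricAlgebra A N) :=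
    ((algebraMap A (SymmetricAlgebra A N)).comp σ).toAlgebra
  (SymmetricAlgebra.lift (R := A') (M := N') (A := SymmetricAlgebra A N)
    { toFun := fun n ↦ SymmetricAlgebra.ι A N (g n)
      map_add' := by simp
      map_smul' := fun a n ↦ by
        rw [LinearMap.map_smulₛₗ, map_smul, Algebra.smul_def, RingHom.id_apply, Algebra.smul_def]
        rfl }).toRingHom

@[simp] theorem symMap_algebraMap {σ : A' →+* A} (g : N' →ₛₗ[σ] N) (a : A') :
    symMap g (algebraMap A' _ a) = algebraMap A _ (σ a) := by
  let : Algebra A' (SymmetricAlgebra A N) :=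
    ((algebraMap A (SymmetricAlgebra A N)).comp σ).toAlgebra
  exact AlgHom.commutes (SymmetricAlgebra.lift (R := A') (M := N') (A := SymmetricAlgebra A N) _) a

@[simp] theorem symMap_iota {σ : A' →+* A} (g : N' →ₛₗ[σ] N) (n : N') :
    symMap g (SymmetricAlgebra.ι A' N' n) = SymmetricAlgebra.ι A N (g n) := by
  let : Algebra A' (SymmetricAlgebra A N) :=
    ((algebraMap A (SymmetricAlgebra A N)).comp σ).toAlgebra
  exact SymmetricAlgebra.lift_ι_apply (R := A') (M := N') (A := SymmetricAlgebra A N) _ n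

theorem symMap_mem {σ : A' →+* A} (g : N' →ₛₗ[σ] N) {d : ℕ} {x : SymmetricAlgebra A' N'}
    (hx : x ∈ gr A' N' d) : symMap g x ∈ gr A N d := by
  change x ∈ LinearMap.range (SymmetricAlgebra.ι A' N') ^ d at hx
  induction hx using Submodule.pow_induction_on_left' with
  | algebraMap r =>
    rw [symMap_algebraMap]
    exact SetLike.algebraMap_mem_graded (gr A N) _
  | add x y i hx hy ihx ihy => rw [map_add]; exact add_mem ihx ihy
  | mem_mul m hm i x hx ih =>
    obtain ⟨m, rfl⟩ := hm
    rw [map_mul, symMap_iota, Nat.succ_eq_add_one, add_comm]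
    exact SetLike.mul_mem_graded (iota_mem A N _) ih

/-- `symMap` as a homomorphism of graded rings. -/
noncomputable def grMap {σ : A' →+* A} (g : N' →ₛₗ[σ] N) :
    GradedRingHom (gr A' N') (gr A N) where
  __ := symMap g
  map_mem hx := symMap_mem g hx

theorem grMap_apply {σ : A' →+* A} (g : N' →ₛₗ[σ] N) (x) : grMap g x = symMap g x := rfl

theorem irrelevant_le {σ : A' →+* A} (g : N' →ₛₗ[σ] N)
    (hg : Submodule.span A (Set.range g) = ⊤) :
    HomogeneousIdeal.irrelevant (gr A N) ≤
      (HomogeneousIdeal.irrelevant (gr A' N')).map (grMap g) := by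
  rw [HomogeneousIdeal.irrelevant_le]
  set I := ((HomogeneousIdeal.irrelevant (gr A' N')).map (grMap g)).toIdeal with hI
  have h1 : ∀ n : N, SymmetricAlgebra.ι A N n ∈ I := by
    intro n
    have hn : n ∈ Submodule.span A (Set.range g) := by rw [hg]; trivial
    induction hn using Submodule.span_induction with
    | mem x hx =>
      obtain ⟨m, rfl⟩ := hx
      rw [← symMap_iota]
      exact Ideal.mem_map_of_mem _
        (HomogeneousIdeal.mem_irrelevant_of_mem _ one_pos (iota_mem A' N' m))
    | zero => rw [map_zero]; exact I.zero_mem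
    | add x y _ _ hx hy => rw [map_add]; exact I.add_mem hx hy
    | smul a x _ hx => rw [map_smul, Algebra.smul_def]; exact I.mul_mem_left _ hx
  intro d hd x hx
  obtain ⟨d, rfl⟩ := Nat.exists_eq_succ_of_ne_zero hd.ne'
  change x ∈ LinearMap.range (SymmetricAlgebra.ι A N) ^ (d + 1) at hx
  change x ∈ I
  rw [pow_succ] at hx
  induction hx using Submodule.mul_induction_on' with
  | mem_mul_mem m hm n hn =>
    obtain ⟨n, rfl⟩ := hn
    exact I.mul_mem_left _ (h1 n)
  | add x _ y _ hx hy => exact I.add_mem hx hy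


section Localization

variable {ι : Type*} (σ : A' →+* A) (f : A') (g : N' →ₛₗ[σ] N)
  (b' : Module.Basis ι A' N') (b : Module.Basis ι A N)

theorem equiv_symMap (hb : ∀ i, g (b' i) = b i) (x : SymmetricAlgebra A' N') :
    SymmetricAlgebra.equivMvPolynomial b (symMap g x) =
      MvPolynomial.map σ (SymmetricAlgebra.equivMvPolynomial b' x) := by
  suffices h : ((SymmetricAlgebra.equivMvPolynomial b).toRingEquiv.toRingHom.comp (symMap g)) =
      (MvPolynomial.map σ).comp (SymmetricAlgebra.equivMvPolynomial b').toRingEquiv.toRingHom from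
    congr($h x)
  have key : ∀ i, SymmetricAlgebra.equivMvPolynomial b (symMap g (SymmetricAlgebra.ι A' N' (b' i))) =
      MvPolynomial.map σ (SymmetricAlgebra.equivMvPolynomial b' (SymmetricAlgebra.ι A' N' (b' i))) := by
    intro i
    rw [symMap_iota, hb]
    simp
  have key0 : ∀ a, SymmetricAlgebra.equivMvPolynomial b (symMap g (algebraMap A' _ a)) =
      MvPolynomial.map σ (SymmetricAlgebra.equivMvPolynomial b' (algebraMap A' _ a)) := by
    intro a
    rw [symMap_algebraMap, AlgEquiv.commutes, AlgEquiv.commutes, MvPolynomial.algebraMap_eq,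
      MvPolynomial.algebraMap_eq, MvPolynomial.map_C]
  refine ringHom_ext key0 fun n ↦ ?_
  change SymmetricAlgebra.equivMvPolynomial b (symMap g _) =
      MvPolynomial.map σ (SymmetricAlgebra.equivMvPolynomial b' _)
  have hn : n ∈ Submodule.span A' (Set.range b') := by rw [b'.span_eq]; trivial
  induction hn using Submodule.span_induction with
  | mem x hx => obtain ⟨i, rfl⟩ := hx; exact key i
  | zero => simp only [map_zero]
  | add x y _ _ hx hy => simp only [map_add, hx, hy]
  | smul a x _ hx => rw [map_smul, Algebra.smul_def]; simp only [map_mul, key0, hx]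

theorem symMap_surj (hf : letI := σ.toAlgebra; IsLocalization.Away f A)
    (hb : ∀ i, g (b' i) = b i) (x : SymmetricAlgebra A N) :
    ∃ (m : ℕ) (y : SymmetricAlgebra A' N'), algebraMap A _ (σ f) ^ m * x = symMap g y := by
  let : Algebra A' A := σ.toAlgebra
  let : Algebra (MvPolynomial ι A') (MvPolynomial ι A) := (MvPolynomial.map σ).toAlgebra
  have : IsLocalization ((Submonoid.powers f).map (MvPolynomial.C (σ := ι))) (MvPolynomial ι A) :=
    MvPolynomial.isLocalization (Submonoid.powers f) A
  obtain ⟨⟨p, ⟨_, _, ⟨m, rfl⟩, rfl⟩⟩, hp⟩ := IsLocalization.surj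
    ((Submonoid.powers f).map (MvPolynomial.C (σ := ι))) (SymmetricAlgebra.equivMvPolynomial b x)
  refine ⟨m, (SymmetricAlgebra.equivMvPolynomial b').symm p, ?_⟩
  apply (SymmetricAlgebra.equivMvPolynomial b).injective
  rw [equiv_symMap σ g b' b hb, AlgEquiv.apply_symm_apply, map_mul, map_pow, AlgEquiv.commutes,
    mul_comm]
  change _ * MvPolynomial.map σ (MvPolynomial.C (f ^ m)) = MvPolynomial.map σ p at hp
  rw [← hp, MvPolynomial.map_C, map_pow, map_pow, MvPolynomial.algebraMap_eq]

theorem symMap_inj (hf : letI := σ.toAlgebra; IsLocalization.Away f A)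
    (hb : ∀ i, g (b' i) = b i) (y : SymmetricAlgebra A' N') (hy : symMap g y = 0) :
    ∃ m : ℕ, algebraMap A' _ f ^ m * y = 0 := by
  let : Algebra A' A := σ.toAlgebra
  let : Algebra (MvPolynomial ι A') (MvPolynomial ι A) := (MvPolynomial.map σ).toAlgebra
  have : IsLocalization ((Submonoid.powers f).map (MvPolynomial.C (σ := ι))) (MvPolynomial ι A) :=
    MvPolynomial.isLocalization (Submonoid.powers f) A
  have h0 : algebraMap (MvPolynomial ι A') (MvPolynomial ι A)
      (SymmetricAlgebra.equivMvPolynomial b' y) = 0 := by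
    change MvPolynomial.map σ _ = 0
    rw [← equiv_symMap σ g b' b hb, hy, map_zero]
  obtain ⟨⟨_, _, ⟨m, rfl⟩, rfl⟩, hp⟩ := (IsLocalization.map_eq_zero_iff
    ((Submonoid.powers f).map (MvPolynomial.C (σ := ι))) (MvPolynomial ι A) _).mp h0
  refine ⟨m, (SymmetricAlgebra.equivMvPolynomial b').injective ?_⟩
  rw [map_zero, map_mul, map_pow, AlgEquiv.commutes, MvPolynomial.algebraMap_eq, ← map_pow]
  exact hp

/-- The structure map of the affine chart. -/
noncomputable def toAway (A N : Type u) [CommRing A] [AddCommGroup N] [Module A N]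
    (a : SymmetricAlgebra A N) : A →+* HomogeneousLocalization.Away (gr A N) a :=
  (HomogeneousLocalization.fromZeroRingHom (gr A N) (Submonoid.powers a)).comp
    (algebraMap A (gr A N 0))

theorem val_toAway (a : SymmetricAlgebra A N) (c : A) :
    (toAway A N a c).val = algebraMap _ _ (algebraMap A (SymmetricAlgebra A N) c) := by
  simp only [toAway, RingHom.comp_apply]
  rfl

theorem map_toAway (a : SymmetricAlgebra A' N') (c : A') :
    HomogeneousLocalization.Away.map (grMap g) a (toAway A' N' a c) =
      toAway A N (grMap g a) (σ c) := by
  apply HomogeneousLocalization.val_injective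
  rw [val_toAway, ← symMap_algebraMap g]
  change (HomogeneousLocalization.Away.map (grMap g) a (HomogeneousLocalization.mk
    ⟨0, algebraMap A' (gr A' N' 0) c, 1, _⟩)).val = _
  rw [HomogeneousLocalization.Away.map, HomogeneousLocalization.map_mk, HomogeneousLocalization.val_mk,
    ← Localization.mk_one_eq_algebraMap]
  congr 1
  exact Subtype.ext (map_one _)

theorem val_toAway_mul_mk {d n : ℕ} {a : SymmetricAlgebra A N} (ha : a ∈ gr A N d) (c : A)
    (x : SymmetricAlgebra A N) (hx : x ∈ gr A N (n • d)) (m : ℕ) :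
    ((toAway A N a c) ^ m * HomogeneousLocalization.Away.mk (gr A N) ha n x hx).val =
      Localization.mk (algebraMap A _ c ^ m * x) ⟨a ^ n, (⟨n, rfl⟩ : a ^ n ∈ Submonoid.powers a)⟩ := by
  rw [HomogeneousLocalization.val_mul, HomogeneousLocalization.val_pow, val_toAway,
    HomogeneousLocalization.Away.val_mk, ← map_pow, ← Localization.mk_one_eq_algebraMap,
    Localization.mk_mul, one_mul]

theorem isLocalization_away (hf : letI := σ.toAlgebra; IsLocalization.Away f A)
    (hb : ∀ i, g (b' i) = b i) {d : ℕ} (a : SymmetricAlgebra A' N') (ha : a ∈ gr A' N' d) :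
    letI := (HomogeneousLocalization.Away.map (grMap g) a).toAlgebra
    IsLocalization.Away (toAway A' N' a f)
      (HomogeneousLocalization.Away (gr A N) (grMap g a)) := by
  have ha' : grMap g a ∈ gr A N d := symMap_mem g ha
  let := (HomogeneousLocalization.Away.map (grMap g) a).toAlgebra
  refine (isLocalization_iff _ _).mpr ⟨?_, ?_, ?_⟩
  · rintro ⟨_, m, rfl⟩
    let := σ.toAlgebra
    have h : IsUnit (σ f) := IsLocalization.Away.algebraMap_isUnit (S := A) f
    change IsUnit (HomogeneousLocalization.Away.map (grMap g) a _)
    rw [map_pow, map_toAway]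
    exact (h.map _).pow m
  · intro z
    obtain ⟨n, x, hx, rfl⟩ := HomogeneousLocalization.Away.mk_surjective (gr A N) ha' z
    obtain ⟨m, y, hy⟩ := symMap_surj σ f g b' b hf hb x
    let y' := DirectSum.decompose (gr A' N') y (n • d)
    have hy' : symMap g y' = algebraMap A _ (σ f) ^ m * x := by
      have h1 : symMap g y' = DirectSum.decompose (gr A N) (symMap g y) (n • d) :=
        GradedRingHom.map_directSumDecompose (𝒜 := gr A' N') (ℬ := gr A N) (grMap g)
      rw [h1, ← hy]
      apply DirectSum.decompose_of_mem_same
      rw [← map_pow, ← Algebra.smul_def]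
      exact Submodule.smul_mem _ _ hx
    refine ⟨⟨HomogeneousLocalization.Away.mk (gr A' N') ha n y' y'.2, ⟨_, m, rfl⟩⟩, ?_⟩
    change _ * HomogeneousLocalization.Away.map (grMap g) a (_ ^ m) =
      HomogeneousLocalization.Away.map (grMap g) a _
    rw [map_pow, map_toAway, mul_comm]
    apply HomogeneousLocalization.val_injective
    rw [val_toAway_mul_mk, HomogeneousLocalization.Away.map_mk, HomogeneousLocalization.Away.val_mk]
    congr 1
    exact hy'.symm
  · intro z w h
    obtain ⟨z, rfl⟩ : ∃ t, z = t + w := ⟨z - w, by ring⟩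
    obtain ⟨n, x, hx, rfl⟩ := HomogeneousLocalization.Away.mk_surjective (gr A' N') ha z
    rw [map_add, add_eq_right] at h
    change HomogeneousLocalization.Away.map (grMap g) a _ = 0 at h
    have h' := congr(HomogeneousLocalization.val $h)
    rw [HomogeneousLocalization.Away.map_mk, HomogeneousLocalization.Away.val_mk,
      HomogeneousLocalization.val_zero, Localization.mk_eq_mk', IsLocalization.mk'_eq_zero_iff] at h'
    obtain ⟨⟨_, k, rfl⟩, hk⟩ := h'
    have hk' : symMap g (a ^ k * x) = 0 := by rw [map_mul, map_pow]; exact hk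
    obtain ⟨m, hm⟩ := symMap_inj σ f g b' b hf hb _ hk'
    refine ⟨⟨_, m, rfl⟩, ?_⟩
    change toAway A' N' a f ^ m * _ = toAway A' N' a f ^ m * w
    rw [mul_add, add_eq_right]
    apply HomogeneousLocalization.val_injective
    rw [val_toAway_mul_mk, HomogeneousLocalization.val_zero, Localization.mk_eq_mk',
      IsLocalization.mk'_eq_zero_iff]
    refine ⟨⟨_, k, rfl⟩, ?_⟩
    change a ^ k * (algebraMap A' _ f ^ m * x) = 0
    rw [← hm]; ring

variable (A N) in
/-- The structure morphism of `Proj (Sym N)` over `Spec A`. -/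
noncomputable def projToSpec : Proj (gr A N) ⟶ Spec (.of A) :=
  Proj.toSpecZero (gr A N) ≫ Spec.map (CommRingCat.ofHom (algebraMap A (gr A N 0)))

theorem awayι_projToSpec {d : ℕ} (hd : 0 < d) (a : SymmetricAlgebra A N) (ha : a ∈ gr A N d) :
    Proj.awayι (gr A N) a ha hd ≫ projToSpec A N = Spec.map (CommRingCat.ofHom (toAway A N a)) := by
  rw [projToSpec, Proj.awayι_toSpecZero_assoc, ← Spec.map_comp]
  rfl

theorem span_range_eq_top (hb : ∀ i, g (b' i) = b i) : Submodule.span A (Set.range g) = ⊤ := by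
  rw [eq_top_iff, ← b.span_eq, Submodule.span_le]
  rintro _ ⟨i, rfl⟩
  exact Submodule.subset_span ⟨b' i, hb i⟩

theorem isPullback_projMap (hf : letI := σ.toAlgebra; IsLocalization.Away f A)
    (hb : ∀ i, g (b' i) = b i) (hg : Submodule.span A (Set.range g) = ⊤) :
    IsPullback (Proj.map (grMap g) (irrelevant_le g hg)) (projToSpec A N) (projToSpec A' N')
      (Spec.map (CommRingCat.ofHom σ)) := by
  refine Scheme.isPullback_of_openCover _ _ _ _ (Proj.affineOpenCover (gr A' N')).openCover ?_
  rintro ⟨⟨d, hd⟩, ⟨a, ha⟩⟩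
  change a ∈ gr A' N' d at ha
  have ha' : grMap g a ∈ gr A N d := symMap_mem g ha
  have h1 : IsPullback (Spec.map (CommRingCat.ofHom (HomogeneousLocalization.Away.map (grMap g) a)))
      (Proj.awayι (gr A N) (grMap g a) ha' hd) (Proj.awayι (gr A' N') a ha hd)
      (Proj.map (grMap g) (irrelevant_le g hg)) :=
    IsOpenImmersion.isPullback _ _ _ _ (Proj.awayι_comp_map _ _ hd a ha) (by
      rw [Proj.opensRange_awayι, Proj.opensRange_awayι, Proj.map_preimage_basicOpen])
  have h2 : IsPullback (Spec.map (CommRingCat.ofHom (HomogeneousLocalization.Away.map (grMap g) a)))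
      (Spec.map (CommRingCat.ofHom (toAway A N (grMap g a))))
      (Spec.map (CommRingCat.ofHom (toAway A' N' a)))
      (Spec.map (CommRingCat.ofHom σ)) := by
    let := σ.toAlgebra
    let := (HomogeneousLocalization.Away.map (grMap g) a).toAlgebra
    have : IsLocalization ((Submonoid.powers f).map (toAway A' N' a))
        (HomogeneousLocalization.Away (gr A N) (grMap g a)) := by
      rw [Submonoid.map_powers]
      exact isLocalization_away σ f g b' b hf hb a ha
    have : IsLocalization (Submonoid.powers f) A := hf
    refine ((CommRingCat.isPushout_of_isLocalization (toAway A' N' a) (toAway A N (grMap g a)) ?_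
      (Submonoid.powers f)).op.map Scheme.Spec).flip
    exact RingHom.ext fun c ↦ (map_toAway σ g a c).symm
  let e := h1.flip.isoPullback
  refine .of_iso h2 e (.refl _) (.refl _) (.refl _) ?_ ?_ ?_ ?_
  · refine (Category.comp_id _).trans ?_
    exact h1.flip.isoPullback_hom_snd.symm
  · refine (Category.comp_id _).trans ?_
    change _ = e.hom ≫ pullback.fst _ _ ≫ _
    rw [← awayι_projToSpec hd _ ha', ← h1.flip.isoPullback_hom_fst, Category.assoc]
  · refine (Category.comp_id _).trans ?_
    exact (awayι_projToSpec hd _ ha).symm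
  · simp

end Localization

variable (A N)

theorem smul_eq_toAway (a : SymmetricAlgebra A N) (c : A)
    (x : HomogeneousLocalization.Away (gr A N) a) : c • x = toAway A N a c * x := by
  apply HomogeneousLocalization.val_injective
  rw [HomogeneousLocalization.val_smul, HomogeneousLocalization.val_mul, val_toAway,
    Algebra.smul_def]
  rfl

noncomputable instance away_algebra (a : SymmetricAlgebra A N) :
    Algebra A (HomogeneousLocalization.Away (gr A N) a) where
  algebraMap := toAway A N a
  commutes' _ _ := mul_comm _ _
  smul_def' c x := smul_eq_toAway A N a c x

/-- The coordinate ring of the affine chart of `Proj (Sym N)` on which `l` does not vanish. -/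
abbrev ChartRing (l : N) : Type u :=
  HomogeneousLocalization.Away (gr A N) (SymmetricAlgebra.ι A N l)

variable {N}

/-- The quotient `m / l`, as a function on the chart on which `l` does not vanish. -/
noncomputable def quot (l m : N) : ChartRing A N l :=
  HomogeneousLocalization.Away.mk (gr A N) (iota_mem A N l) 1 (SymmetricAlgebra.ι A N m)
    (iota_mem A N m)

/-- The generator `e` of the tautological line subbundle of the pullback of the dual of `N` on the
chart on which `l` does not vanish, normalized by `e(l) = 1`: it is the linear form `m ↦ m / l`,
written in terms of a basis of `N`. -/
noncomputable def taut {n : ℕ} (b : Module.Basis (Fin n) A N) (l : N) :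
    ChartRing A N l ⊗[A] Module.Dual A N :=
  ∑ j, quot A l (b j) ⊗ₜ[A] b.coord j

/-- For `m : N` all of whose coordinates lie in the ideal `I`, the composition of
`N^∨ → I`, `t ↦ t m`, with `I → I / I ^ 2 → (A ⧸ I) ⊗ Ω[A⁄k]`, `f ↦ 1 ⊗ df`. -/
noncomputable def dualToKaehler (k : Type u) [CommRing k] [Algebra k A] (I : Ideal A) (m : N)
    (hm : ∀ t : Module.Dual A N, t m ∈ I) :
    Module.Dual A N →ₗ[A] (A ⧸ I) ⊗[A] Ω[A⁄k] where
  toFun t := 1 ⊗ₜ[A] KaehlerDifferential.D k A (t m)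
  map_add' t t' := by rw [LinearMap.add_apply, map_add, TensorProduct.tmul_add]
  map_smul' a t := by
    have h : (1 : A ⧸ I) ⊗ₜ[A] (t m • KaehlerDifferential.D k A a) = 0 := by
      rw [← TensorProduct.smul_tmul, Algebra.smul_def, Ideal.Quotient.algebraMap_eq,
        Ideal.Quotient.eq_zero_iff_mem.mpr (hm t), zero_mul, TensorProduct.zero_tmul]
    rw [LinearMap.smul_apply, smul_eq_mul, Derivation.leibniz, TensorProduct.tmul_add, h, add_zero,
      TensorProduct.tmul_smul, RingHom.id_apply]

end Algebra

noncomputable section Bundle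

variable {V : Scheme.{u}}

/-- Restriction of sections of an `𝒪_V`-module, as a semilinear map. -/
def res (M : V.Modules) {U W : V.Opens} (h : W ≤ U) :
    Γ(M, U) →ₛₗ[(V.presheaf.map (homOfLE h).op).hom] Γ(M, W) where
  toFun := M.presheaf.map (homOfLE h).op
  map_add' := map_add _
  map_smul' a x := Scheme.Modules.map_smul M (homOfLE h) a x

theorem res_res (M : V.Modules) {U W T : V.Opens} (h : W ≤ U) (h' : T ≤ W) (x : Γ(M, U)) :
    res M h' (res M h x) = res M (h'.trans h) x := by
  change M.presheaf.map _ (M.presheaf.map _ x) = M.presheaf.map _ x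
  rw [← ConcreteCategory.comp_apply, ← Functor.map_comp]
  rfl

theorem res_self (M : V.Modules) {U : V.Opens} (x : Γ(M, U)) : res M (le_refl U) x = x := by
  change M.presheaf.map (𝟙 _) x = x
  rw [CategoryTheory.Functor.map_id]
  rfl

/-- `b` is a frame of `M` over `U`: its restriction to every open subset `W` of `U` is a basis of
`Γ(M, W)` over `Γ(V, W)`, so that `b` is an isomorphism `𝒪_U ^ n ≅ M|_U`. -/
def IsFrame (M : V.Modules) (U : V.Opens) {n : ℕ} (b : Fin n → Γ(M, U)) : Prop :=
  ∀ (W : V.Opens) (h : W ≤ U), LinearIndependent Γ(V, W) (fun j ↦ res M h (b j)) ∧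
    Submodule.span Γ(V, W) (Set.range fun j ↦ res M h (b j)) = ⊤

theorem IsFrame.res {M : V.Modules} {U W : V.Opens} {n : ℕ} {b : Fin n → Γ(M, U)}
    (hb : IsFrame M U b) (h : W ≤ U) : IsFrame M W fun j ↦ res M h (b j) := by
  intro T h'
  simp only [res_res]
  exact hb T (h'.trans h)

/-- The basis given by a frame. -/
def IsFrame.basis {M : V.Modules} {U : V.Opens} {n : ℕ} {b : Fin n → Γ(M, U)}
    (hb : IsFrame M U b) {W : V.Opens} (h : W ≤ U) : Module.Basis (Fin n) Γ(V, W) Γ(M, W) :=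
  .mk (hb W h).1 (hb W h).2.ge

theorem IsFrame.basis_apply {M : V.Modules} {U : V.Opens} {n : ℕ} {b : Fin n → Γ(M, U)}
    (hb : IsFrame M U b) {W : V.Opens} (h : W ≤ U) (j) :
    hb.basis h j = ProjBundle.res M h (b j) := by
  simp [IsFrame.basis]

variable (V) in
/-- A vector bundle of rank `n` on `V`, given by its sheaf of sections: an `𝒪_V`-module which is
locally free of rank `n`. -/
structure VectorBundle (n : ℕ) where
  /-- The sheaf of sections. -/
  sheaf : V.Modules
  locally_free (x : V) : ∃ U : V.Opens, x ∈ U ∧ ∃ b : Fin n → Γ(sheaf, U), IsFrame sheaf U b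

namespace VectorBundle

variable {n : ℕ} (E : VectorBundle V n)

/-- The affine open subsets of `V` over which `E` is trivial, ordered by `D(f) ≤ U` for
`f ∈ Γ(V, U)`. -/
def Patch : Type u :=
  {U : V.AffineZariskiSite // ∃ b : Fin n → Γ(E.sheaf, U.toOpens), IsFrame E.sheaf U.toOpens b}

instance : Preorder E.Patch :=
  inferInstanceAs (Preorder {U : V.AffineZariskiSite // _})

variable {E} in
/-- The underlying open subset. -/
abbrev Patch.opens (U : E.Patch) : V.Opens := U.1.toOpens

variable {E} in
theorem Patch.le {U W : E.Patch} (h : W ≤ U) : W.opens ≤ U.opens :=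
  Scheme.AffineZariskiSite.toOpens_mono (show W.1 ≤ U.1 from h)

variable {E} in
/-- The smaller patch `D(f)`. -/
def Patch.basicOpen (U : E.Patch) (f : Γ(V, U.opens)) : E.Patch :=
  ⟨U.1.basicOpen f, U.2.elim fun _ hb ↦ ⟨_, hb.res (V.basicOpen_le f)⟩⟩

variable {E} in
theorem Patch.basicOpen_le (U : E.Patch) (f : Γ(V, U.opens)) : U.basicOpen f ≤ U :=
  U.1.basicOpen_le f

theorem exists_patch (x : V) : ∃ U : E.Patch, x ∈ U.opens := by
  obtain ⟨U, hx, b, hb⟩ := E.locally_free x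
  obtain ⟨_, ⟨W, hW, rfl⟩, hxW, hWU⟩ := V.isBasis_affineOpens.exists_subset_of_mem_open hx U.2
  exact ⟨⟨⟨W, hW⟩, _, hb.res hWU⟩, hxW⟩

/-- The cover of `V` by the affine open subsets over which `E` is trivial. -/
abbrev cover : V.OpenCover where
  I₀ := E.Patch
  X U := U.opens
  f U := U.opens.ι
  mem₀ := by
    rw [Scheme.presieve₀_mem_precoverage_iff]
    refine ⟨fun x ↦ ?_, inferInstance⟩
    obtain ⟨U, hxU⟩ := E.exists_patch x
    exact ⟨U, ⟨x, hxU⟩, rfl⟩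

instance : E.cover.LocallyDirected where
  trans f := V.homOfLE (Patch.le f.le)
  trans_id _ := Scheme.homOfLE_rfl _ _
  trans_comp _ _ := (Scheme.homOfLE_homOfLE _ _ _).symm
  w _ := Scheme.homOfLE_ι _ _
  directed {U W} x := by
    let a := (pullback.fst _ _ ≫ U.opens.ι) x
    have haU : a ∈ U.opens := (pullback.fst U.opens.ι W.opens.ι x).2
    have haV : a ∈ W.opens := by
      unfold a; rw [pullback.condition]; exact (pullback.snd U.opens.ι W.opens.ι x).2
    obtain ⟨f, g, e, hxf⟩ := exists_basicOpen_le_affine_inter U.1.2 W.1.2 _ ⟨haU, haV⟩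
    refine ⟨U.basicOpen f, homOfLE (U.basicOpen_le f), homOfLE ⟨g, e.symm⟩, ⟨a, hxf⟩, ?_⟩
    apply (pullback.fst _ _ ≫ U.opens.ι).isOpenEmbedding.injective
    change (pullback.lift _ _ _ ≫ pullback.fst _ _ ≫ U.opens.ι) _ = _
    simp only [pullback.lift_fst_assoc, Scheme.homOfLE_ι, Scheme.Opens.ι_apply]
    rfl

variable {E} in
theorem Patch.span_res {U W : E.Patch} (h : W ≤ U) :
    Submodule.span Γ(V, W.opens) (Set.range (res E.sheaf (Patch.le h))) = ⊤ := by
  obtain ⟨b, hb⟩ := U.2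
  exact span_range_eq_top _ _ (hb.basis le_rfl) (hb.basis (Patch.le h)) fun i ↦ by
    rw [hb.basis_apply, hb.basis_apply, res_res]

variable {E} in
theorem Patch.grMap_self (U : E.Patch) :
    grMap (res E.sheaf (le_refl U.opens)) =
      GradedRingHom.id (gr Γ(V, U.opens) Γ(E.sheaf, U.opens)) := by
  refine GradedRingHom.ext fun x ↦ ?_
  suffices h : symMap (res E.sheaf (le_refl U.opens)) = RingHom.id _ from congr($h x)
  refine ringHom_ext (fun a ↦ ?_) fun m ↦ ?_
  · rw [symMap_algebraMap]
    change algebraMap _ _ (V.presheaf.map (𝟙 _) a) = _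
    rw [CategoryTheory.Functor.map_id]
    rfl
  · rw [symMap_iota, res_self]
    rfl

variable {E} in
theorem Patch.grMap_comp {U W T : E.Patch} (h : W ≤ U) (h' : T ≤ W) :
    grMap (res E.sheaf (Patch.le (h'.trans h))) =
      (grMap (res E.sheaf (Patch.le h'))).comp (grMap (res E.sheaf (Patch.le h))) := by
  refine GradedRingHom.ext fun x ↦ ?_
  suffices h : symMap (res E.sheaf (Patch.le (h'.trans h))) =
      (symMap (res E.sheaf (Patch.le h'))).comp (symMap (res E.sheaf (Patch.le h))) from
    congr($h x)
  refine ringHom_ext (fun a ↦ ?_) fun m ↦ ?_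
  · rw [symMap_algebraMap, RingHom.comp_apply, symMap_algebraMap, symMap_algebraMap]
    congr 1
    change _ = V.presheaf.map _ (V.presheaf.map _ a)
    rw [← ConcreteCategory.comp_apply, ← Functor.map_comp]
    rfl
  · rw [symMap_iota, RingHom.comp_apply, symMap_iota, symMap_iota, res_res]

/-- `U ↦ Proj (Sym Γ(E, U))`. -/
def projFunctor : E.Patch ⥤ Scheme.{u} where
  obj U := Proj (gr Γ(V, U.opens) Γ(E.sheaf, U.opens))
  map h := Proj.map (grMap (res E.sheaf (Patch.le h.le))) (irrelevant_le _ (Patch.span_res h.le))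
  map_id U := by
    rw [← Proj.map_id]
    congr 1
    exact Patch.grMap_self U
  map_comp h h' := by
    rw [← Proj.map_comp]
    congr 1
    exact Patch.grMap_comp h'.le h.le

variable {E} in
theorem Patch.isPullback {U W : E.Patch} (h : W ≤ U) :
    IsPullback (E.projFunctor.map (homOfLE h))
      (projToSpec Γ(V, W.opens) Γ(E.sheaf, W.opens)) (projToSpec Γ(V, U.opens) Γ(E.sheaf, U.opens))
      (Spec.map (V.presheaf.map (homOfLE (Patch.le h)).op)) := by
  obtain ⟨b, hb⟩ := U.2
  obtain ⟨f, hf⟩ := id h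
  obtain rfl : U.basicOpen f = W := Subtype.ext (Subtype.ext hf)
  refine isPullback_projMap (V.presheaf.map (homOfLE (V.basicOpen_le f)).op).hom f
    (res E.sheaf (V.basicOpen_le f)) (hb.basis le_rfl) (hb.basis (V.basicOpen_le f))
    (U.1.2.isLocalization_basicOpen f) (fun i ↦ ?_) (Patch.span_res h)
  rw [hb.basis_apply, hb.basis_apply, res_res]

variable {E} in
theorem Patch.isPullback_isoSpec {U W : E.Patch} (h : W ≤ U) :
    IsPullback (Spec.map (V.presheaf.map (homOfLE (Patch.le h)).op)) W.1.2.isoSpec.inv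
      U.1.2.isoSpec.inv (V.homOfLE (Patch.le h)) :=
  .of_vert_isIso ⟨((Scheme.AffineZariskiSite.restrictIsoSpec V).inv.naturality
    (homOfLE (show W.1 ≤ U.1 from h)))⟩

/-- The schemes `Proj (Sym Γ(E, U))` over the affine open subsets `U` trivializing `E`, as gluing
data over `V`. -/
def gluingData : E.cover.RelativeGluingData where
  functor := E.projFunctor
  natTrans :=
    { app U := projToSpec Γ(V, U.opens) Γ(E.sheaf, U.opens) ≫ U.1.2.isoSpec.inv
      naturality _ _ h := ((Patch.isPullback h.le).paste_vert (Patch.isPullback_isoSpec h.le)).w }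
  equifibered _ _ h := (Patch.isPullback h.le).paste_vert (Patch.isPullback_isoSpec h.le)

/-- The projective bundle `Proj (Sym 𝓔)` where `𝓔` is the sheaf of sections of `E`. Its points
are the lines in the fibers of the dual bundle of `E`. -/
def proj : Scheme.{u} := E.gluingData.glued

/-- The projection to `V`. -/
def π : E.proj ⟶ V := E.gluingData.toBase

/-- The affine chart of the projective bundle over `U` on which the section `l` of `E`, a linear
form on the fibers of the dual bundle, does not vanish. -/
def chart (U : E.Patch) (l : Γ(E.sheaf, U.opens)) :
    Spec (.of (ChartRing Γ(V, U.opens) Γ(E.sheaf, U.opens) l)) ⟶ E.proj :=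
  Proj.awayι (gr Γ(V, U.opens) Γ(E.sheaf, U.opens)) _ (iota_mem _ _ l) one_pos ≫
    E.gluingData.cover.f U

end VectorBundle

/-- The ideal of `R` cutting out the pullback to `Spec R` of a closed subscheme. -/
def onSpec {Y : Scheme.{u}} (J : Y.IdealSheafData) {R : CommRingCat.{u}} (f : Spec R ⟶ Y) :
    Ideal R :=
  ((J.comap f).ideal ⟨⊤, isAffineOpen_top _⟩).comap (Scheme.ΓSpecIso R).inv.hom

/-- The `k`-algebra of functions on an open subset of a scheme over `k`. -/
abbrev sectionsAlgebra {k : Type u} [CommRing k] {Y : Scheme.{u}} (p : Y ⟶ Spec (.of k))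
    (W : Y.Opens) : Algebra k Γ(Y, W) :=
  ((Scheme.ΓSpecIso (.of k)).inv ≫ p.appLE ⊤ W le_top).hom.toAlgebra

/-- The ideal sheaf of the singularity subscheme of the closed subscheme `Z` of `Y` with ideal sheaf
`I`, for `Y` over `k`: the largest closed subscheme of `Z` on which the morphism
`I / I ^ 2 → Ω_Y|_Z`, `f ↦ df`, vanishes. -/
def singularityIdeal {k : Type u} [CommRing k] {Y : Scheme.{u}} (p : Y ⟶ Spec (.of k))
    (I : Y.IdealSheafData) : Y.IdealSheafData :=
  sInf {J | I ≤ J ∧ ∀ W : Y.affineOpens, ∀ f ∈ I.ideal W,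
    letI := sectionsAlgebra p W
    KaehlerDifferential.D k Γ(Y, W) f ∈ J.ideal W • (⊤ : Submodule Γ(Y, W) Ω[Γ(Y, W)⁄k])}

namespace VectorBundle

variable {n : ℕ} (E : VectorBundle V n) (s : Γ(E.sheaf, ⊤))

variable {E} in
/-- The restriction to `U` of a global section of `E`. -/
abbrev Patch.sec (U : E.Patch) (s : Γ(E.sheaf, ⊤)) : Γ(E.sheaf, U.opens) :=
  res E.sheaf le_top s

/-- `X` is the ideal sheaf of the zero scheme of the section `s` of `E`: it is the image of the
morphism from the sheaf of sections of the dual bundle to `𝒪_V` given by evaluation at `s`. -/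
def IsZeroScheme (X : V.IdealSheafData) : Prop :=
  ∀ U : E.Patch, X.ideal ⟨U.opens, U.1.2⟩ =
    LinearMap.range (Module.Dual.eval Γ(V, U.opens) Γ(E.sheaf, U.opens) (U.sec s))

/-- The ideal sheaf of the zero scheme of the section `ε ∘ π^* s` of `𝒪(1)` on the projective bundle,
where `ε` is the canonical morphism from `π^* E` to `𝒪(1)`: the largest closed subscheme on which
this section vanishes. On the chart on which `l` does not vanish, `𝒪(1)` is trivialized by `ε(l)`,
and `ε(m) = (m / l) ε(l)`. -/
def hypersurfaceIdeal : E.proj.IdealSheafData :=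
  sInf {J | ∀ (U : E.Patch) (l : Γ(E.sheaf, U.opens)),
    quot Γ(V, U.opens) l (U.sec s) ∈ onSpec J (E.chart U l)}

variable {E s} in
theorem IsZeroScheme.dual_mem {X : V.IdealSheafData} (hX : E.IsZeroScheme s X) (U : E.Patch)
    (t : Module.Dual Γ(V, U.opens) Γ(E.sheaf, U.opens)) :
    t (U.sec s) ∈ X.ideal ⟨U.opens, U.1.2⟩ := by
  rw [hX U]
  exact ⟨t, rfl⟩

/-- The ideal sheaf in the projective bundle of the zero scheme of the composition
`𝒪(-1) → ρ^* E^∨|_X → ρ^* T^*V|_X` over the part of the projective bundle over `X`, where `X` is the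
zero scheme of `s` and `E^∨|_X → T^*V|_X` is the composition of evaluation at `s` with
`I_X / I_X ^ 2 → Ω_V|_X`: the largest closed subscheme, contained in the inverse image of `X`,
on which this composition vanishes. -/
def tyurinaIdeal {k : Type u} [CommRing k] (p : V ⟶ Spec (.of k)) {X : V.IdealSheafData}
    (hX : E.IsZeroScheme s X) : E.proj.IdealSheafData :=
  sInf {J | X.comap E.π ≤ J ∧ ∀ (U : E.Patch) (l : Γ(E.sheaf, U.opens))
    (b : Module.Basis (Fin n) Γ(V, U.opens) Γ(E.sheaf, U.opens)),
    letI := sectionsAlgebra p U.opens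
    (dualToKaehler Γ(V, U.opens) k (X.ideal ⟨U.opens, U.1.2⟩) (U.sec s) (hX.dual_mem U)).baseChange
        (ChartRing Γ(V, U.opens) Γ(E.sheaf, U.opens) l) (taut Γ(V, U.opens) b l) ∈
      onSpec J (E.chart U l) • (⊤ : Submodule (ChartRing Γ(V, U.opens) Γ(E.sheaf, U.opens) l)
        (ChartRing Γ(V, U.opens) Γ(E.sheaf, U.opens) l ⊗[Γ(V, U.opens)]
          ((Γ(V, U.opens) ⧸ X.ideal ⟨U.opens, U.1.2⟩) ⊗[Γ(V, U.opens)] Ω[Γ(V, U.opens)⁄k])))}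

end VectorBundle

end Bundle

end ProjBundle

/-! Everything is decided on charts. Let A be the ring of a patch, N its module of sections of the
bundle, l in N, and R the chart ring, generated over A by the quotients m/l. If s = Σ f_j y_j in a
basis y_j of N, the hypersurface has the equation F = s/l = Σ f_j (y_j/l), and dF = Σ (y_j/l) df_j +
Σ f_j d(y_j/l). Let J be an ideal of R. If all f_j lie in J, then F lies in J and the second sum
lies in J Ω_R, while the first is the image of the tautological generator under φ; so the condition
defining 𝒴 implies the one defining the singular locus (`D_mem_of_baseChange_mem`). Conversely, let
F lie in J and dF in J Ω_R. Then D F lies in J M for every derivation D of R into a module M, and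
two kinds of derivation suffice. One that is zero on A and moves the fiber coordinates along a
linear form t sends F to t(s) - F t(l), so every t(s) lies in J (`IsChart.algebraMap_dual_mem`). One
that extends d on A sends F to the tautological composition minus a multiple of F
(`IsChart.baseChange_mem`). Both come from `IsChart.exists_derivation`, where the universal property
of R is applied to a square-zero extension.

Both ideal sheaves are infima of sets of ideal sheaves, and the computation shows that the two sets
are equal (`IsZeroScheme.tyurinaIdeal_eq_singularityIdeal`). For this the condition on differentials
over all affine opens is compared with the one on charts (`D_mem_onSpec`, `D_mem_of_onSpec`), and
the hypersurface ideal has to be generated by s/l on each chart (`onSpec_hypersurfaceIdeal`), which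
by linearity of m ↦ m/l is also the second assertion. The latter is not formal, since an infinite
infimum of ideal sheaves need not be computed chart by chart. An ideal sheaf with these local
equations is therefore constructed, using that s/l and s/l' differ by the factor l'/l on overlaps.
-/

namespace ProjBundle

/-! ### Ideal sheaves of effective divisors given by local equations -/

section CartierDivisor

variable {Y : Scheme.{u}}

/-- Restriction of functions, as a ring homomorphism. -/
abbrev resHom {U W : Y.Opens} (h : W ≤ U) : Γ(Y, U) →+* Γ(Y, W) :=
  (Y.presheaf.map (homOfLE h).op).hom

theorem resHom_resHom {U W T : Y.Opens} (h : W ≤ U) (h' : T ≤ W) (x : Γ(Y, U)) :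
    resHom h' (resHom h x) = resHom (h'.trans h) x := by
  rw [resHom, resHom, ← ConcreteCategory.comp_apply, ← Functor.map_comp]
  rfl

theorem germ_resHom {U W : Y.Opens} (h : W ≤ U) {x : Y} (hx : x ∈ W) (f : Γ(Y, U)) :
    Y.presheaf.germ W x hx (resHom h f) = Y.presheaf.germ U x (h hx) f :=
  Y.presheaf.germ_res_apply (homOfLE h) x hx f

/-- The quotient germ extends to a neighbourhood, and the identity between germs becomes an identity
of functions on a small enough principal open. -/
theorem exists_basicOpen_dvd_of_germ_dvd {W : Y.Opens} (hW : IsAffineOpen W) {σ f : Γ(Y, W)}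
    {x : Y} (hx : x ∈ W) (h : Y.presheaf.germ W x hx σ ∣ Y.presheaf.germ W x hx f) :
    ∃ g : Γ(Y, W), x ∈ Y.basicOpen g ∧
      resHom (Y.basicOpen_le g) σ ∣ resHom (Y.basicOpen_le g) f := by
  obtain ⟨a, ha⟩ := h
  obtain ⟨T, hxT, a, rfl⟩ := Y.presheaf.exists_germ_eq a
  have hTW : T ⊓ W ≤ W := inf_le_right
  have hx' : x ∈ T ⊓ W := ⟨hxT, hx⟩
  have h1 : Y.presheaf.germ (T ⊓ W) x hx' (resHom hTW f) =
      Y.presheaf.germ (T ⊓ W) x hx' (resHom hTW σ * resHom inf_le_left a) := by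
    rw [map_mul, germ_resHom, germ_resHom, germ_resHom, ha]
  obtain ⟨T', hxT', i, i', e⟩ := Y.presheaf.germ_eq x hx' hx' _ _ h1
  obtain ⟨g, hg, hxg⟩ := hW.exists_basicOpen_le ⟨x, hxT'⟩ hx
  have e' := congr(resHom hg $e)
  change resHom hg (resHom i.le _) = resHom hg (resHom i'.le _) at e'
  rw [map_mul, map_mul, resHom_resHom, resHom_resHom, resHom_resHom, resHom_resHom] at e'
  exact ⟨g, hxg, _, e'⟩

/-- Divisibility is membership in a principal ideal, which may be checked on the localizations at
elements generating the unit ideal. The local quotients need not agree, so σ may be a zero divisor.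
-/
theorem dvd_of_germ_dvd {W : Y.Opens} (hW : IsAffineOpen W) {σ f : Γ(Y, W)}
    (h : ∀ x hx, Y.presheaf.germ W x hx σ ∣ Y.presheaf.germ W x hx f) : σ ∣ f := by
  choose g hg hd using fun x : W ↦ exists_basicOpen_dvd_of_germ_dvd hW x.2 (h x x.2)
  have hspan : Ideal.span (Set.range g) = ⊤ := by
    rw [← hW.self_le_iSup_basicOpen_iff]
    exact fun x hx ↦ TopologicalSpace.Opens.mem_iSup.mpr ⟨⟨_, _, rfl⟩, hg ⟨x, hx⟩⟩
  have inst := hW.isLocalization_basicOpen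
  rw [← Ideal.mem_span_singleton]
  refine Submodule.mem_of_isLocalized_span _ hspan (fun i ↦ Γ(Y, Y.basicOpen i.1))
    (fun i ↦ Algebra.linearMap Γ(Y, W) Γ(Y, Y.basicOpen i.1)) ?_
  rintro ⟨_, j, rfl⟩
  simp only [← Submodule.restrictScalars_localized' Γ(Y, Y.basicOpen (g j)),
    Ideal.localized'_eq_map, Submodule.restrictScalars_mem]
  rw [Ideal.map_span, Set.image_singleton, Ideal.mem_span_singleton]
  exact hd j

variable {ι : Type*} (U : ι → Y.Opens) (σ : ∀ i, Γ(Y, U i))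

/-- The ideal of the functions on `W` which are locally divisible by the functions `σ i`. -/
def divisorIdeal (W : Y.Opens) : Ideal Γ(Y, W) where
  carrier := {f | ∀ i x (hx : x ∈ W) (hi : x ∈ U i),
    Y.presheaf.germ (U i) x hi (σ i) ∣ Y.presheaf.germ W x hx f}
  zero_mem' _ _ _ _ := by rw [map_zero]; exact dvd_zero _
  add_mem' hf hg i x hx hi := by rw [map_add]; exact dvd_add (hf i x hx hi) (hg i x hx hi)
  smul_mem' c f hf i x hx hi := by
    rw [smul_eq_mul, map_mul]; exact (hf i x hx hi).mul_left _

variable {U σ}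

theorem resHom_mem_divisorIdeal {W T : Y.Opens} (h : T ≤ W) {f : Γ(Y, W)}
    (hf : f ∈ divisorIdeal U σ W) : resHom h f ∈ divisorIdeal U σ T := fun i x hx hi ↦ by
  rw [germ_resHom]; exact hf i x (h hx) hi

theorem dvd_of_mem_divisorIdeal {W : Y.Opens} (hW : IsAffineOpen W) {i : ι} (h : W ≤ U i)
    {f : Γ(Y, W)} (hf : f ∈ divisorIdeal U σ W) : resHom h (σ i) ∣ f :=
  dvd_of_germ_dvd hW fun x hx ↦ by rw [germ_resHom]; exact hf i x hx (h hx)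

/-- This is quasi-coherence. A section over D(g) has the form h/g^k, and some g^n h must satisfy the
divisibility conditions on all of W. Near each point the conditions reduce to one principal ideal,
where denominators can be cleared; compactness of W makes the exponent uniform. -/
theorem map_divisorIdeal_basicOpen (hU : ∀ i, IsAffineOpen (U i)) (hcov : ⨆ i, U i = ⊤)
    (hσ : ∀ i j x (hi : x ∈ U i) (hj : x ∈ U j),
      Y.presheaf.germ (U i) x hi (σ i) ∣ Y.presheaf.germ (U j) x hj (σ j))
    {W : Y.Opens} (hW : IsAffineOpen W) (g : Γ(Y, W)) :
    (divisorIdeal U σ W).map (resHom (Y.basicOpen_le g)) = divisorIdeal U σ (Y.basicOpen g) := by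
  refine le_antisymm (Ideal.map_le_iff_le_comap.mpr fun f hf ↦ resHom_mem_divisorIdeal _ hf) ?_
  intro f hf
  have := hW.isLocalization_basicOpen g
  obtain ⟨h, ⟨_, k, rfl⟩, rfl⟩ := IsLocalization.exists_mk'_eq (.powers g) f
  refine (IsLocalization.mk'_mem_map_algebraMap_iff _ _ _ _ _).mpr ?_
  have hh : resHom (Y.basicOpen_le g) h ∈ divisorIdeal U σ (Y.basicOpen g) := by
    rw [← show algebraMap _ _ (g ^ k) * _ = resHom (Y.basicOpen_le g) h from
      IsLocalization.mk'_spec' _ h (⟨_, k, rfl⟩ : Submonoid.powers g)]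
    exact Ideal.mul_mem_left _ _ hf
  suffices H : ∃ n, ∀ x ∈ (W : Set Y), ∀ (hx : x ∈ W) i (hi : x ∈ U i),
      Y.presheaf.germ (U i) x hi (σ i) ∣ Y.presheaf.germ W x hx (g ^ n * h) by
    obtain ⟨n, hn⟩ := H
    exact ⟨_, ⟨n, rfl⟩, fun i x hx hi ↦ hn x hx hx i hi⟩
  refine hW.isCompact.induction_on (p := fun S ↦ ∃ n, ∀ x ∈ S, ∀ (hx : x ∈ W) i (hi : x ∈ U i),
      Y.presheaf.germ (U i) x hi (σ i) ∣ Y.presheaf.germ W x hx (g ^ n * h)) ?_ ?_ ?_ ?_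
  · exact ⟨0, fun x hx ↦ hx.elim⟩
  · exact fun S T hST ⟨n, hn⟩ ↦ ⟨n, fun x hx ↦ hn x (hST hx)⟩
  · rintro S T ⟨n, hn⟩ ⟨m, hm⟩
    refine ⟨n + m, fun x hx hxW i hi ↦ ?_⟩
    rcases hx with hx | hx
    · rw [add_comm, pow_add, mul_assoc, map_mul]
      exact (hn x hx hxW i hi).mul_left _
    · rw [pow_add, mul_assoc, map_mul]
      exact (hm x hx hxW i hi).mul_left _
  · intro x hx
    obtain ⟨i, hi⟩ := TopologicalSpace.Opens.mem_iSup.mp (hcov.ge (Set.mem_univ x))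
    -- D(e) is affine and lies in both W and U i, so on it the single equation σ i is available.
    obtain ⟨e, e', hee, hxe⟩ := exists_basicOpen_le_affine_inter hW (hU i) x ⟨hx, hi⟩
    have heW := Y.basicOpen_le e
    have hei : Y.basicOpen e ≤ U i := hee.le.trans (Y.basicOpen_le e')
    refine ⟨Y.basicOpen e, mem_nhdsWithin_of_mem_nhds ((Y.basicOpen e).2.mem_nhds hxe), ?_⟩
    have hA := hW.basicOpen e
    have hge : Y.basicOpen (resHom heW g) ≤ Y.basicOpen g := by
      rw [Scheme.basicOpen_res]; exact inf_le_right
    have hd := dvd_of_mem_divisorIdeal (hA.basicOpen (resHom heW g))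
      ((Y.basicOpen_le _).trans hei) (resHom_mem_divisorIdeal hge hh)
    have := hA.isLocalization_basicOpen (resHom heW g)
    have hmem : algebraMap _ Γ(Y, Y.basicOpen (resHom heW g)) (resHom heW h) ∈
        (Ideal.span {resHom hei (σ i)}).map (algebraMap _ _) := by
      rw [Ideal.map_span, Set.image_singleton, Ideal.mem_span_singleton]
      change resHom (Y.basicOpen_le _) _ ∣ resHom (Y.basicOpen_le _) _
      rw [resHom_resHom, resHom_resHom]
      rwa [resHom_resHom] at hd
    obtain ⟨_, ⟨n, rfl⟩, hn⟩ := (IsLocalization.algebraMap_mem_map_algebraMap_iff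
      (.powers (resHom heW g)) _ _ _).mp hmem
    rw [Ideal.mem_span_singleton] at hn
    -- At y the equation σ j divides σ i, so divisibility by σ i settles every index j.
    refine ⟨n, fun y hy hyW j hj ↦ (hσ j i y hj (hei hy)).trans ?_⟩
    have := map_dvd (Y.presheaf.germ _ y hy).hom hn
    change Y.presheaf.germ _ y hy _ ∣ Y.presheaf.germ _ y hy (resHom heW g ^ n * resHom heW h)
      at this
    rwa [← map_pow, ← map_mul, germ_resHom, germ_resHom] at this

/-- An effective divisor given by local equations, as an ideal sheaf. -/
theorem exists_idealSheafData_of_germ_dvd (hU : ∀ i, IsAffineOpen (U i)) (hcov : ⨆ i, U i = ⊤)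
    (hσ : ∀ i j x (hi : x ∈ U i) (hj : x ∈ U j),
      Y.presheaf.germ (U i) x hi (σ i) ∣ Y.presheaf.germ (U j) x hj (σ j)) :
    ∃ J : Y.IdealSheafData, ∀ i, J.ideal ⟨U i, hU i⟩ = Ideal.span {σ i} := by
  refine ⟨⟨fun W ↦ divisorIdeal U σ W, fun W g ↦ map_divisorIdeal_basicOpen hU hcov hσ W.2 g,
    _, rfl⟩, fun i ↦ le_antisymm (fun f hf ↦ ?_) ?_⟩
  · rw [Ideal.mem_span_singleton]
    have := dvd_of_mem_divisorIdeal (hU i) le_rfl hf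
    rwa [resHom, show (homOfLE (le_refl (U i))).op = 𝟙 _ from rfl,
      CategoryTheory.Functor.map_id] at this
  · rw [Ideal.span_singleton_le_iff_mem]
    exact fun j x hx hj ↦ hσ j i x hj hx

end CartierDivisor

/-! ### Functoriality and locality of the condition df ∈ J Ω -/

section Kaehler

variable {k B : Type u} [CommRing k] [CommRing B] [Algebra k B]

theorem D_mem_smul_top_of_ringHom {R : Type u} [CommRing R] [Algebra k R] (φ : B →+* R)
    (hφ : φ.comp (algebraMap k B) = algebraMap k R) {I : Ideal B} {J : Ideal R}
    (hIJ : I ≤ J.comap φ) {b : B}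
    (hb : KaehlerDifferential.D k B b ∈ I • (⊤ : Submodule B Ω[B⁄k])) :
    KaehlerDifferential.D k R (φ b) ∈ J • (⊤ : Submodule R Ω[R⁄k]) := by
  let := φ.toAlgebra
  have : IsScalarTower k B R := .of_algebraMap_eq' hφ.symm
  have key : ∀ x ∈ I • (⊤ : Submodule B Ω[B⁄k]),
      KaehlerDifferential.map k k B R x ∈ J • (⊤ : Submodule R Ω[R⁄k]) := by
    intro x hx
    induction hx using Submodule.smul_induction_on' with
    | smul r hr n _ =>
      rw [map_smul, ← algebraMap_smul R r]
      exact Submodule.smul_mem_smul (show algebraMap B R r ∈ J from hIJ hr) trivial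
    | add x _ y _ hx hy => rw [map_add]; exact add_mem hx hy
  have := key _ hb
  rwa [KaehlerDifferential.map_D] at this

theorem D_mem_smul_top_of_mem_map {A : Type u} [CommRing A] (φ : A →+* B) {I : Ideal A}
    {J : Ideal B} (hIJ : I ≤ J.comap φ)
    (h : ∀ a ∈ I, KaehlerDifferential.D k B (φ a) ∈ J • (⊤ : Submodule B Ω[B⁄k]))
    {b : B} (hb : b ∈ I.map φ) :
    KaehlerDifferential.D k B b ∈ J • (⊤ : Submodule B Ω[B⁄k]) := by
  -- Membership of b in J is carried through the induction, because d(ax) = a dx + x da and the last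
  -- term is controlled only by x ∈ J.
  suffices H : b ∈ J ∧ KaehlerDifferential.D k B b ∈ J • (⊤ : Submodule B Ω[B⁄k]) from H.2
  induction hb using Submodule.span_induction with
  | mem x hx => obtain ⟨a, ha, rfl⟩ := hx; exact ⟨hIJ ha, h a ha⟩
  | zero => rw [map_zero]; exact ⟨zero_mem _, zero_mem _⟩
  | add x y _ _ hx hy => rw [map_add]; exact ⟨add_mem hx.1 hy.1, add_mem hx.2 hy.2⟩
  | smul a x _ hx =>
    rw [smul_eq_mul, Derivation.leibniz]
    exact ⟨J.mul_mem_left _ hx.1, add_mem (Submodule.smul_mem _ _ hx.2)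
      (Submodule.smul_mem_smul hx.1 trivial)⟩

/-- Kähler differentials commute with localization, so membership in the submodule J Ω can be tested
on the pieces of a cover by principal opens. -/
theorem D_mem_smul_top_of_span {s : Set B} (hs : Ideal.span s = ⊤) (Bₛ : s → Type u)
    [∀ r, CommRing (Bₛ r)] [∀ r, Algebra B (Bₛ r)] [∀ r, Algebra k (Bₛ r)]
    [∀ r, IsScalarTower k B (Bₛ r)] [∀ r, IsLocalization.Away r.1 (Bₛ r)] {J : Ideal B} {b : B}
    (h : ∀ r, KaehlerDifferential.D k (Bₛ r) (algebraMap B _ b) ∈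
      J.map (algebraMap B (Bₛ r)) • (⊤ : Submodule (Bₛ r) Ω[Bₛ r⁄k])) :
    KaehlerDifferential.D k B b ∈ J • (⊤ : Submodule B Ω[B⁄k]) := by
  refine Submodule.mem_of_isLocalized_span s hs (fun r ↦ Ω[Bₛ r⁄k])
    (fun r ↦ KaehlerDifferential.map k k B (Bₛ r)) fun r ↦ ?_
  rw [KaehlerDifferential.map_D]
  rw [← Submodule.restrictScalars_localized' (Bₛ r), Submodule.restrictScalars_mem]
  refine (Submodule.smul_le.mpr ?_ : _ ≤ Submodule.localized' (Bₛ r) (.powers r.1)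
    (KaehlerDifferential.map k k B (Bₛ r)) (J • ⊤)) (h r)
  intro a ha n _
  induction ha using Submodule.span_induction with
  | mem x hx =>
    obtain ⟨a, ha, rfl⟩ := hx
    obtain ⟨⟨n, t⟩, rfl⟩ := IsLocalizedModule.mk'_surjective (.powers r.1)
      (KaehlerDifferential.map k k B (Bₛ r)) n
    rw [Function.uncurry_apply_pair]
    rw [algebraMap_smul, ← IsLocalizedModule.mk'_smul]
    exact ⟨_, Submodule.smul_mem_smul ha trivial, t, rfl⟩
  | zero => rw [zero_smul]; exact zero_mem _
  | add x y _ _ hx hy => rw [add_smul]; exact add_mem hx hy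
  | smul c x _ hx => rw [smul_assoc]; exact Submodule.smul_mem _ _ hx

end Kaehler

/-! ### Ideal sheaves and differentials on affine charts -/

section Charts

variable {Y : Scheme.{u}}

/-- The functions on the image of an affine chart. -/
noncomputable def chartHom {R : CommRingCat.{u}} (c : Spec R ⟶ Y) [IsOpenImmersion c] :
    R →+* Γ(Y, c ''ᵁ ⊤) :=
  ((Scheme.ΓSpecIso R).inv ≫ (c.appIso ⊤).inv).hom

theorem chartHom_bijective {R : CommRingCat.{u}} (c : Spec R ⟶ Y) [IsOpenImmersion c] :
    Function.Bijective (chartHom c) :=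
  ConcreteCategory.bijective_of_isIso ((Scheme.ΓSpecIso R).inv ≫ (c.appIso ⊤).inv)

/-- The image of an affine chart. -/
noncomputable abbrev chartOpen {R : CommRingCat.{u}} (c : Spec R ⟶ Y) [IsOpenImmersion c] : Y.affineOpens :=
  ⟨c ''ᵁ ⊤, (isAffineOpen_top _).image_of_isOpenImmersion c⟩

theorem onSpec_eq_comap {R : CommRingCat.{u}} (c : Spec R ⟶ Y) [IsOpenImmersion c]
    (J : Y.IdealSheafData) : onSpec J c = (J.ideal (chartOpen c)).comap (chartHom c) := by
  rw [onSpec, J.ideal_comap_of_isOpenImmersion c, Ideal.comap_comap]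
  rfl

theorem map_onSpec {R : CommRingCat.{u}} (c : Spec R ⟶ Y) [IsOpenImmersion c]
    (J : Y.IdealSheafData) : (onSpec J c).map (chartHom c) = J.ideal (chartOpen c) := by
  rw [onSpec_eq_comap, Ideal.map_comap_of_surjective _ (chartHom_bijective c).2]

theorem onSpec_mono {R : CommRingCat.{u}} (c : Spec R ⟶ Y) [IsOpenImmersion c]
    {I J : Y.IdealSheafData} (h : I ≤ J) : onSpec I c ≤ onSpec J c := by
  rw [onSpec_eq_comap, onSpec_eq_comap]
  exact Ideal.comap_mono (h _)

section Cover

variable {ι : Type*} {R : ι → CommRingCat.{u}} (c : ∀ i, Spec (R i) ⟶ Y)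
  [∀ i, IsOpenImmersion (c i)]

theorem iSup_chartOpen (hc : ∀ y, ∃ i, y ∈ Set.range (c i)) : ⨆ i, (chartOpen (c i)).1 = ⊤ := by
  refine eq_top_iff.mpr fun y _ ↦ ?_
  obtain ⟨i, x, rfl⟩ := hc y
  exact TopologicalSpace.Opens.mem_iSup.mpr ⟨i, x, trivial, rfl⟩

theorem le_iff_onSpec_le (hc : ∀ y, ∃ i, y ∈ Set.range (c i)) {I J : Y.IdealSheafData} :
    I ≤ J ↔ ∀ i, onSpec I (c i) ≤ onSpec J (c i) := by
  refine ⟨fun h i ↦ onSpec_mono _ h, fun h ↦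
    Scheme.IdealSheafData.le_of_iSup_eq_top (fun i ↦ chartOpen (c i)) (iSup_chartOpen c hc)
      fun i ↦ ?_⟩
  rw [← map_onSpec, ← map_onSpec]
  exact Ideal.map_mono (h i)

end Cover

theorem chartOpen_le {R S : CommRingCat.{u}} (c : Spec R ⟶ Y) [IsOpenImmersion c] (j : Spec S ⟶ Y)
    [IsOpenImmersion j] (φ : R ⟶ S) (h : j = Spec.map φ ≫ c) : j ''ᵁ ⊤ ≤ c ''ᵁ ⊤ := by
  subst h
  rintro _ ⟨x, -, rfl⟩
  exact ⟨Spec.map φ x, trivial, rfl⟩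

theorem resHom_chartHom {R S : CommRingCat.{u}} (c : Spec R ⟶ Y) [IsOpenImmersion c]
    (j : Spec S ⟶ Y) [IsOpenImmersion j] (φ : R ⟶ S) (h : j = Spec.map φ ≫ c) (r : R) :
    resHom (chartOpen_le c j φ h) (chartHom c r) = chartHom j (φ r) := by
  have key : (Scheme.ΓSpecIso R).inv ≫ (c.appIso ⊤).inv ≫
      Y.presheaf.map (homOfLE (chartOpen_le c j φ h)).op =
      φ ≫ (Scheme.ΓSpecIso S).inv ≫ (j.appIso ⊤).inv := by
    rw [Scheme.ΓSpecIso_inv_naturality_assoc, Iso.inv_comp_eq, Iso.hom_inv_id_assoc,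
      Iso.inv_comp_eq, ← Category.assoc, Iso.eq_comp_inv, Scheme.Hom.appIso_hom',
      Scheme.Hom.appIso_hom']
    subst h
    rw [Scheme.Hom.map_appLE]
    have := Scheme.Hom.appLE_comp_appLE (Spec.map φ) c (c ''ᵁ ⊤) ⊤ ⊤ (c.preimage_image_eq ⊤).ge le_top
    exact this.symm.trans congr(_ ≫ $((Scheme.Hom.app_eq_appLE (Spec.map φ) (U := ⊤)).symm))
  exact congr($key r)

theorem chartHom_comp_algebraMap {k R : Type u} [CommRing k] [CommRing R] (ρ : k →+* R)
    (q : Y ⟶ Spec (.of k)) (c : Spec (.of R) ⟶ Y) [IsOpenImmersion c]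
    (h : c ≫ q = Spec.map (CommRingCat.ofHom ρ)) :
    letI := sectionsAlgebra q (c ''ᵁ ⊤)
    (chartHom c).comp ρ = algebraMap k Γ(Y, c ''ᵁ ⊤) := by
  have key : CommRingCat.ofHom ρ ≫ (Scheme.ΓSpecIso (.of R)).inv ≫ (c.appIso ⊤).inv =
      (Scheme.ΓSpecIso (.of k)).inv ≫ q.appLE ⊤ (c ''ᵁ ⊤) le_top := by
    rw [Scheme.ΓSpecIso_inv_naturality_assoc, Iso.inv_comp_eq, Iso.hom_inv_id_assoc,
      Iso.comp_inv_eq, Scheme.Hom.appIso_hom']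
    refine Eq.trans ?_ (Scheme.Hom.appLE_comp_appLE c q ⊤ (c ''ᵁ ⊤) ⊤ le_top
      (c.preimage_image_eq ⊤).ge).symm
    simp only [h]
    exact Scheme.Hom.app_eq_appLE _
  exact congr(($key).hom)

theorem onSpec_le_iff_comap_le {R : CommRingCat.{u}} (c : Spec R ⟶ Y) (I J : Y.IdealSheafData) :
    onSpec I c ≤ onSpec J c ↔ I.comap c ≤ J.comap c := by
  refine ⟨fun h ↦ Scheme.IdealSheafData.le_of_isAffine ?_, fun h ↦ Ideal.comap_mono (h _)⟩
  have hb := ConcreteCategory.bijective_of_isIso (Scheme.ΓSpecIso R).inv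
  have := Ideal.map_mono (f := (Scheme.ΓSpecIso R).inv.hom) h
  rwa [onSpec, onSpec, Ideal.map_comap_of_surjective _ hb.2,
    Ideal.map_comap_of_surjective _ hb.2] at this

/-- The ideal of an inverse image is never computed: the adjunction between `comap` and `map` turns
a comparison upstairs into one on Spec A, where pushforward along an affine morphism is contraction
of ideals. -/
theorem comap_onSpec_le_iff {V : Scheme.{u}} {A R : CommRingCat.{u}} (q : Y ⟶ V) (c : Spec R ⟶ Y)
    (d : Spec A ⟶ V) (φ : A ⟶ R) (h : c ≫ q = Spec.map φ ≫ d) (X : V.IdealSheafData)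
    (J : Y.IdealSheafData) :
    onSpec (X.comap q) c ≤ onSpec J c ↔ (onSpec X d).map φ.hom ≤ onSpec J c := by
  rw [onSpec_le_iff_comap_le, ← Scheme.IdealSheafData.comap_comp, h,
    Scheme.IdealSheafData.comap_comp, ← Scheme.IdealSheafData.le_map_iff_comap_le,
    Ideal.map_le_iff_le_comap]
  have key : ((J.comap c).map (Spec.map φ)).ideal ⟨⊤, isAffineOpen_top _⟩ =
      ((J.comap c).ideal ⟨⊤, isAffineOpen_top _⟩).comap (Spec.map φ).appTop.hom :=
    Scheme.IdealSheafData.ideal_map_of_isAffineHom _ _ _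
  have hA := ConcreteCategory.bijective_of_isIso (Scheme.ΓSpecIso A).inv
  have key2 : (onSpec J c).comap φ.hom = (((J.comap c).map (Spec.map φ)).ideal
      ⟨⊤, isAffineOpen_top _⟩).comap (Scheme.ΓSpecIso A).inv.hom := by
    rw [key, onSpec, Ideal.comap_comap, Ideal.comap_comap, ← CommRingCat.hom_comp,
      ← CommRingCat.hom_comp, Scheme.ΓSpecIso_inv_naturality]
  rw [key2]
  refine ⟨fun h ↦ Ideal.comap_mono (h _), fun h ↦ Scheme.IdealSheafData.le_of_isAffine ?_⟩
  have := Ideal.map_mono (f := (Scheme.ΓSpecIso A).inv.hom) h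
  rwa [onSpec, Ideal.map_comap_of_surjective _ hA.2,
    Ideal.map_comap_of_surjective _ hA.2] at this

theorem onSpec_fromSpec {V : Scheme.{u}} {U : V.Opens} (hU : IsAffineOpen U)
    (X : V.IdealSheafData) : onSpec X hU.fromSpec = X.ideal ⟨U, hU⟩ := by
  rw [onSpec_eq_comap]
  -- The image of `fromSpec` equals U only propositionally; quantifying over W with U = W allows the
  -- equality to be substituted away.
  have h1 : ∀ (W : V.affineOpens) (hW : U = W.1) (ψ : Γ(V, U) →+* Γ(V, W.1)),
      ψ = resHom hW.ge → (X.ideal W).comap ψ = X.ideal ⟨U, hU⟩ := by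
    rintro ⟨W, hW'⟩ hW ψ rfl
    dsimp only at hW
    subst hW
    rw [resHom, show (homOfLE (le_refl U)).op = 𝟙 _ from rfl, CategoryTheory.Functor.map_id]
    exact Ideal.comap_id _
  have h2 : hU.fromSpec ''ᵁ ⊤ = U := by
    rw [Scheme.Hom.image_top_eq_opensRange, hU.opensRange_fromSpec]
  refine h1 (chartOpen hU.fromSpec) h2.symm _ ?_
  have key : (Scheme.ΓSpecIso Γ(V, U)).inv ≫ (hU.fromSpec.appIso ⊤).inv =
      V.presheaf.map (homOfLE h2.le).op := by
    rw [Iso.comp_inv_eq, Scheme.Hom.appIso_hom', Scheme.Hom.map_appLE, Scheme.Hom.appLE,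
      hU.fromSpec_app_self, Category.assoc, ← Functor.map_comp]
    exact (Category.comp_id _).symm.trans congr(_ ≫ $((CategoryTheory.Functor.map_id _ _).symm))
  exact congr(($key).hom)

theorem resHom_comp_algebraMap {k : Type u} [CommRing k] (q : Y ⟶ Spec (.of k)) {W T : Y.Opens}
    (h : T ≤ W) :
    letI := sectionsAlgebra q W
    letI := sectionsAlgebra q T
    (resHom h).comp (algebraMap k Γ(Y, W)) = algebraMap k Γ(Y, T) := by
  have key : ((Scheme.ΓSpecIso (.of k)).inv ≫ q.appLE ⊤ W le_top) ≫
      Y.presheaf.map (homOfLE h).op = (Scheme.ΓSpecIso (.of k)).inv ≫ q.appLE ⊤ T le_top :=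
    (Category.assoc _ _ _).trans
      congr(_ ≫ $(Scheme.Hom.appLE_map q (U := ⊤) le_top (homOfLE h).op))
  exact congr(($key).hom)

section Singular

variable {k : Type u} [CommRing k] (q : Y ⟶ Spec (.of k)) {I J : Y.IdealSheafData}

theorem D_mem_onSpec {R : Type u} [CommRing R] [Algebra k R] (c : Spec (.of R) ⟶ Y)
    [IsOpenImmersion c] (h : c ≫ q = Spec.map (CommRingCat.ofHom (algebraMap k R)))
    (hIJ : ∀ W : Y.affineOpens, ∀ f ∈ I.ideal W, letI := sectionsAlgebra q W
      KaehlerDifferential.D k Γ(Y, W) f ∈ J.ideal W • (⊤ : Submodule Γ(Y, W) Ω[Γ(Y, W)⁄k]))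
    {f : R} (hf : f ∈ onSpec I c) :
    KaehlerDifferential.D k R f ∈ onSpec J c • (⊤ : Submodule R Ω[R⁄k]) := by
  let := sectionsAlgebra q (c ''ᵁ ⊤)
  let e := RingEquiv.ofBijective (chartHom c) (chartHom_bijective c)
  have he := chartHom_comp_algebraMap _ q c h
  rw [onSpec_eq_comap] at hf
  have := D_mem_smul_top_of_ringHom (k := k) (e.symm : Γ(Y, c ''ᵁ ⊤) →+* R) (J := onSpec J c) (by
    rw [← he]; ext a; exact e.symm_apply_apply _) (fun x hx ↦ by
      rw [onSpec_eq_comap, Ideal.mem_comap, Ideal.mem_comap]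
      exact (e.apply_symm_apply x).symm ▸ hx) (hIJ (chartOpen c) _ hf)
  rwa [show (e.symm : Γ(Y, c ''ᵁ ⊤) →+* R) (chartHom c f) = f from e.symm_apply_apply f] at this

/-- An arbitrary affine W is covered by opens that are principal both in W and in the image of a
chart. On such an open, I is generated by the restriction of the chart's ideal, so Leibniz and
functoriality carry the condition over. The Leibniz step is where I ≤ J enters. -/
theorem D_mem_of_onSpec {ι : Type*} {R : ι → Type u} [∀ i, CommRing (R i)] [∀ i, Algebra k (R i)]
    (c : ∀ i, Spec (.of (R i)) ⟶ Y) [∀ i, IsOpenImmersion (c i)]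
    (hc : ∀ y, ∃ i, y ∈ Set.range (c i))
    (h : ∀ i, c i ≫ q = Spec.map (CommRingCat.ofHom (algebraMap k (R i)))) (hIJ : I ≤ J)
    (hD : ∀ i, ∀ f ∈ onSpec I (c i),
      KaehlerDifferential.D k (R i) f ∈ onSpec J (c i) • (⊤ : Submodule (R i) Ω[R i⁄k]))
    (W : Y.affineOpens) (f : Γ(Y, W)) (hf : f ∈ I.ideal W) :
    letI := sectionsAlgebra q W
    KaehlerDifferential.D k Γ(Y, W) f ∈ J.ideal W • (⊤ : Submodule Γ(Y, W) Ω[Γ(Y, W)⁄k]) := by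
  let := sectionsAlgebra q W
  have hex : ∀ y : W.1, ∃ (i : ι) (g : Γ(Y, W)) (g' : Γ(Y, c i ''ᵁ ⊤)),
      Y.basicOpen g = Y.basicOpen g' ∧ y.1 ∈ Y.basicOpen g := fun ⟨y, hy⟩ ↦ by
    obtain ⟨i, hi⟩ := TopologicalSpace.Opens.mem_iSup.mp
      ((iSup_chartOpen c hc).ge (Set.mem_univ y))
    exact ⟨i, exists_basicOpen_le_affine_inter W.2 (chartOpen (c i)).2 _ ⟨hy, hi⟩⟩
  choose i g g' e hg using hex
  have hspan : Ideal.span (Set.range g) = ⊤ := by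
    rw [← W.2.self_le_iSup_basicOpen_iff]
    exact fun x hx ↦ TopologicalSpace.Opens.mem_iSup.mpr ⟨⟨_, _, rfl⟩, hg ⟨x, hx⟩⟩
  have inst := W.2.isLocalization_basicOpen
  let (r : Set.range g) : Algebra k Γ(Y, Y.basicOpen r.1) := sectionsAlgebra q _
  have (r : Set.range g) : IsScalarTower k Γ(Y, W) Γ(Y, Y.basicOpen r.1) :=
    .of_algebraMap_eq' (resHom_comp_algebraMap q (Y.basicOpen_le r.1)).symm
  refine D_mem_smul_top_of_span hspan (fun r ↦ Γ(Y, Y.basicOpen r.1)) ?_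
  rintro ⟨_, j, rfl⟩
  -- Naming the ideal fixes its ring as the functions on `Y.basicOpen (g j)`, rather than on the
  -- underlying open of the affine open, which is the same only by unfolding.
  obtain ⟨JD, hJD⟩ : ∃ JD : Ideal Γ(Y, Y.basicOpen (g j)),
    JD = J.ideal (Y.affineBasicOpen (g j)) := ⟨_, rfl⟩
  have hJ : (J.ideal W).map (algebraMap Γ(Y, W) Γ(Y, Y.basicOpen (g j))) = JD :=
    hJD ▸ J.map_ideal_basicOpen _ _
  have hle : Y.basicOpen (g j) ≤ c (i j) ''ᵁ ⊤ := (e j).le.trans (Y.basicOpen_le _)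
  have hI : (I.ideal (chartOpen (c (i j)))).map (resHom hle) =
      I.ideal (Y.affineBasicOpen (g j)) := I.map_ideal (U := Y.affineBasicOpen (g j)) (V := chartOpen (c (i j))) hle
  let : Algebra k Γ(Y, Y.basicOpen (g j)) := sectionsAlgebra q _
  dsimp only
  rw [hJ]
  have hf' : algebraMap Γ(Y, W) Γ(Y, Y.basicOpen (g j)) f ∈
      (onSpec I (c (i j))).map ((resHom hle).comp (chartHom (c (i j)))) := by
    rw [← Ideal.map_map, map_onSpec, hI, ← I.map_ideal_basicOpen]
    exact Ideal.mem_map_of_mem _ hf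
  have hIJ' : onSpec J (c (i j)) ≤ JD.comap
      ((resHom hle).comp (chartHom (c (i j)))) := by
    rw [← Ideal.map_le_iff_le_comap, ← Ideal.map_map, map_onSpec, hJD]
    exact (J.map_ideal (U := Y.affineBasicOpen (g j)) (V := chartOpen (c (i j))) hle).le
  refine D_mem_smul_top_of_mem_map _ ((onSpec_mono _ hIJ).trans hIJ') (fun a ha ↦ ?_) hf'
  refine D_mem_smul_top_of_ringHom _ ?_ hIJ' (hD _ a ha)
  let := sectionsAlgebra q (c (i j) ''ᵁ ⊤)
  rw [RingHom.comp_assoc, chartHom_comp_algebraMap _ q _ (h (i j))]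
  exact resHom_comp_algebraMap q hle

end Singular

end Charts

/-! ### The universal property of the chart rings -/

section ChartRing

variable {A N : Type u} [CommRing A] [AddCommGroup N] [Module A N]

/-- The ring homomorphism from the symmetric algebra induced by a semilinear map. -/
noncomputable def symLift {B : Type u} [CommRing B] {φ : A →+* B} (g : N →ₛₗ[φ] B) :
    SymmetricAlgebra A N →+* B :=
  letI := φ.toAlgebra
  (SymmetricAlgebra.lift (R := A) (M := N) (A := B)
    { toFun := g
      map_add' := map_add g
      map_smul' := fun a n ↦ by rw [g.map_smulₛₗ, RingHom.id_apply, Algebra.smul_def]; rfl }).toRingHom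

theorem symLift_algebraMap {B : Type u} [CommRing B] {φ : A →+* B} (g : N →ₛₗ[φ] B) (a : A) :
    symLift g (algebraMap A _ a) = φ a := by
  let := φ.toAlgebra
  exact AlgHom.commutes (SymmetricAlgebra.lift (R := A) (M := N) (A := B) _) a

theorem symLift_iota {B : Type u} [CommRing B] {φ : A →+* B} (g : N →ₛₗ[φ] B) (n : N) :
    symLift g (SymmetricAlgebra.ι A N n) = g n := by
  let := φ.toAlgebra
  exact SymmetricAlgebra.lift_ι_apply (R := A) (M := N) (A := B) _ n

theorem val_quot (l m : N) : (quot A l m).val = Localization.mk (SymmetricAlgebra.ι A N m)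
    ⟨SymmetricAlgebra.ι A N l, Submonoid.mem_powers _⟩ := by
  rw [quot, HomogeneousLocalization.Away.val_mk]
  congr 1
  exact Subtype.ext (pow_one _)

theorem quot_add (l m m' : N) : quot A l (m + m') = quot A l m + quot A l m' := by
  apply HomogeneousLocalization.val_injective
  rw [HomogeneousLocalization.val_add, val_quot, val_quot, val_quot, map_add,
    Localization.add_mk_self]

theorem quot_smul (l m : N) (a : A) : quot A l (a • m) = a • quot A l m := by
  apply HomogeneousLocalization.val_injective
  rw [HomogeneousLocalization.val_smul, val_quot, val_quot, map_smul, Localization.smul_mk]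

/-- `m ↦ m / l` as a linear map. -/
noncomputable def quotLin (l : N) : N →ₗ[A] ChartRing A N l where
  toFun := quot A l
  map_add' := quot_add l
  map_smul' a m := quot_smul l m a

theorem quot_self (l : N) : quot A l l = 1 := by
  apply HomogeneousLocalization.val_injective
  rw [val_quot, HomogeneousLocalization.val_one]
  exact Localization.mk_self (⟨_, Submonoid.mem_powers _⟩ :
    Submonoid.powers (SymmetricAlgebra.ι A N l))

/-- A semilinear map `g` to a ring with `g l = 1` induces a ring homomorphism from the chart
on which `l` does not vanish. -/
noncomputable def chartLift {B : Type u} [CommRing B] {φ : A →+* B} (g : N →ₛₗ[φ] B) (l : N)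
    (hl : g l = 1) : ChartRing A N l →+* B :=
  (IsLocalization.Away.lift (S := Localization.Away (SymmetricAlgebra.ι A N l))
    (SymmetricAlgebra.ι A N l) (g := symLift g)
    (by rw [symLift_iota, hl]; exact isUnit_one)).comp
  (algebraMap (ChartRing A N l) (Localization.Away (SymmetricAlgebra.ι A N l)))

theorem chartLift_algebraMap {B : Type u} [CommRing B] {φ : A →+* B} (g : N →ₛₗ[φ] B) (l : N)
    (hl : g l = 1) (a : A) : chartLift g l hl (algebraMap A _ a) = φ a := by
  rw [chartLift, RingHom.comp_apply, HomogeneousLocalization.algebraMap_apply]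
  change IsLocalization.Away.lift _ _ (toAway A N _ a).val = _
  rw [val_toAway, IsLocalization.Away.lift_eq, symLift_algebraMap]

theorem chartLift_quot {B : Type u} [CommRing B] {φ : A →+* B} (g : N →ₛₗ[φ] B) (l : N)
    (hl : g l = 1) (m : N) : chartLift g l hl (quot A l m) = g m := by
  rw [chartLift, RingHom.comp_apply, HomogeneousLocalization.algebraMap_apply, val_quot,
    Localization.mk_eq_mk', IsLocalization.Away.lift, IsLocalization.lift_mk'_spec, symLift_iota]
  change _ = symLift g (SymmetricAlgebra.ι A N l) * _
  rw [symLift_iota, hl, one_mul]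

/-- A form of degree n is a sum of products of n linear forms with coefficients in A, so x/l^n is a
polynomial over A in the quotients m/l. -/
theorem chartRing_hom_ext {B : Type u} [CommRing B] {l : N} {F G : ChartRing A N l →+* B}
    (h₀ : ∀ a, F (algebraMap A _ a) = G (algebraMap A _ a))
    (h₁ : ∀ m, F (quot A l m) = G (quot A l m)) : F = G := by
  have key : ∀ (n : ℕ) (x : SymmetricAlgebra A N) (hx : x ∈ LinearMap.range
      (SymmetricAlgebra.ι A N) ^ n) (hx' : x ∈ gr A N (n • 1)),
      F (HomogeneousLocalization.Away.mk (gr A N) (iota_mem A N l) n x hx') =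
        G (HomogeneousLocalization.Away.mk (gr A N) (iota_mem A N l) n x hx') := by
    intro n x hx
    induction hx using Submodule.pow_induction_on_left' with
    | algebraMap r =>
      intro hx'
      have : HomogeneousLocalization.Away.mk (gr A N) (iota_mem A N l) 0
          (algebraMap A _ r) hx' = algebraMap A (ChartRing A N l) r := by
        apply HomogeneousLocalization.val_injective
        change _ = (toAway A N _ r).val
        rw [val_toAway, HomogeneousLocalization.Away.val_mk, ← Localization.mk_one_eq_algebraMap]
        congr 1
        exact Subtype.ext (pow_zero _)
      rw [this, h₀]
    | add x y i hx hy ihx ihy =>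
      intro hx'
      have e : i • 1 = i := by simp
      have hx1 : x ∈ gr A N (i • 1) := by rw [e]; exact hx
      have hy1 : y ∈ gr A N (i • 1) := by rw [e]; exact hy
      have : HomogeneousLocalization.Away.mk (gr A N) (iota_mem A N l) i (x + y) hx' =
          HomogeneousLocalization.Away.mk (gr A N) (iota_mem A N l) i x hx1 +
          HomogeneousLocalization.Away.mk (gr A N) (iota_mem A N l) i y hy1 := by
        apply HomogeneousLocalization.val_injective
        rw [HomogeneousLocalization.val_add, HomogeneousLocalization.Away.val_mk,
          HomogeneousLocalization.Away.val_mk, HomogeneousLocalization.Away.val_mk,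
          Localization.add_mk_self]
      rw [this, map_add, map_add, ihx, ihy]
    | mem_mul m hm i x hx ih =>
      intro hx'
      obtain ⟨m, rfl⟩ := hm
      have e : i • 1 = i := by simp
      have hx1 : x ∈ gr A N (i • 1) := by rw [e]; exact hx
      have : HomogeneousLocalization.Away.mk (gr A N) (iota_mem A N l) i.succ
          (SymmetricAlgebra.ι A N m * x) hx' = quot A l m *
          HomogeneousLocalization.Away.mk (gr A N) (iota_mem A N l) i x hx1 := by
        apply HomogeneousLocalization.val_injective
        rw [HomogeneousLocalization.val_mul, val_quot, HomogeneousLocalization.Away.val_mk,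
          HomogeneousLocalization.Away.val_mk, Localization.mk_mul]
        congr 1
        exact Subtype.ext (pow_succ' _ _)
      rw [this, map_mul, map_mul, ih, h₁]
  refine RingHom.ext fun z ↦ ?_
  obtain ⟨n, x, hx, rfl⟩ := HomogeneousLocalization.Away.mk_surjective (gr A N) (iota_mem A N l) z
  exact key n x (by simpa using! hx) hx

end ChartRing

/-! ### Derivations of the chart rings and the two local implications -/

section ChartDerivation

variable {A N : Type u} [CommRing A] [AddCommGroup N] [Module A N] {R : Type u} [CommRing R]
  [Algebra A R]

/-- The universal property of the ring of functions `m / l` on the chart on which `l` does not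
vanish. -/
structure IsChart (l : N) (q : N →ₗ[A] R) : Prop where
  apply_self : q l = 1
  exists_lift {B : Type u} [CommRing B] {φ : A →+* B} (g : N →ₛₗ[φ] B) (hg : g l = 1) :
    ∃ F : R →+* B, (∀ a, F (algebraMap A R a) = φ a) ∧ ∀ m, F (q m) = g m
  hom_ext {B : Type u} [CommRing B] {F G : R →+* B}
    (h₀ : ∀ a, F (algebraMap A R a) = G (algebraMap A R a)) (h₁ : ∀ m, F (q m) = G (q m)) : F = G

/-- The arguments with derivations use only this universal property, so homogeneous localizations do
not enter them. -/
theorem isChart_quotLin (l : N) : IsChart l (quotLin (A := A) l) where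
  apply_self := quot_self l
  exists_lift g hg := ⟨chartLift g l hg, chartLift_algebraMap g l hg, chartLift_quot g l hg⟩
  hom_ext := chartRing_hom_ext

variable {k : Type u} [CommRing k] [Algebra k R] {l : N} {q : N →ₗ[A] R}

theorem derivation_mem_smul_top {M : Type u} [AddCommGroup M]
    [Module R M] [Module k M] [IsScalarTower k R M] (D : Derivation k R M) {J : Ideal R} {f : R}
    (hf : KaehlerDifferential.D k R f ∈ J • (⊤ : Submodule R Ω[R⁄k])) :
    D f ∈ J • (⊤ : Submodule R M) := by
  have := Submodule.mem_map_of_mem (f := D.liftKaehlerDifferential) hf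
  rw [Submodule.map_smul'', Derivation.liftKaehlerDifferential_comp_D] at this
  exact Submodule.smul_mono le_rfl le_top this

variable [Algebra k A] [IsScalarTower k A R]

/-- A derivation of `A` extends to the chart ring, with prescribed values on the functions
`m ↦ m / l` up to a multiple of `m / l`. -/
theorem IsChart.exists_derivation (hq : IsChart l q) {M : Type u} [AddCommGroup M] [Module R M]
    [Module A M] [IsScalarTower A R M] [Module k M]
    [IsScalarTower k R M] (d : Derivation k A M) (e : N →+ M)
    (he : ∀ (a : A) (m : N), e (a • m) = a • e m + q m • d a) :
    ∃ D : Derivation k R M, (∀ a, D (algebraMap A _ a) = d a) ∧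
      ∀ m, D (q m) = e m - q m • e l := by
  let : Module Rᵐᵒᵖ M := Module.compHom M
    ((RingHom.id R).fromOpposite mul_comm)
  have : IsCentralScalar R M := ⟨fun _ _ ↦ rfl⟩
  -- A derivation is the same as a ring homomorphism a ↦ (a, d a) into the square-zero extension R ⊕
  -- M.
  let φ : A →+* TrivSqZeroExt R M :=
    { toFun a := (algebraMap A _ a, d a)
      map_one' := TrivSqZeroExt.ext (map_one _) d.map_one_eq_zero
      map_zero' := TrivSqZeroExt.ext (map_zero _) (map_zero d)
      map_add' a b := TrivSqZeroExt.ext (map_add _ _ _) (map_add d _ _)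
      map_mul' a b := TrivSqZeroExt.ext (map_mul _ _ _) (by
        change d (a * b) = algebraMap A R a • d b +
          algebraMap A R b • d a
        rw [Derivation.leibniz, algebraMap_smul, algebraMap_smul]) }
  -- This is the quotient rule: d(m/l) = dm/l - (m/l) dl/l, with `e` in the role of dm/l. The
  -- correction term makes the value at l equal to 1, as the universal property requires.
  let g : N →ₛₗ[φ] TrivSqZeroExt R M :=
    { toFun m := (q m, e m - q m • e l)
      map_add' m m' := TrivSqZeroExt.ext (map_add q m m') (by
        change e (m + m') - q (m + m') • e l = (e m - q m • e l) +
          (e m' - q m' • e l)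
        rw [map_add, map_add, add_smul]; abel)
      map_smul' a m := TrivSqZeroExt.ext
        ((map_smul q a m).trans (Algebra.smul_def a (q m))) (by
        change e (a • m) - q (a • m) • e l = algebraMap A R a •
          (e m - q m • e l) + q m • d a
        rw [he, map_smul, algebraMap_smul, smul_sub, smul_assoc]; abel) }
  have hg : g l = 1 := TrivSqZeroExt.ext hq.apply_self (by
    change e l - q l • e l = 0
    rw [hq.apply_self, one_smul, sub_self])
  obtain ⟨F, hFA, hFN⟩ := hq.exists_lift g hg
  -- Uniqueness makes F a section of R ⊕ M → R, so its second component is a derivation.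
  have hfst (z : R) : (F z).fst = z := by
    have : (TrivSqZeroExt.fstHom R R M :
        TrivSqZeroExt R M →+* R).comp F = RingHom.id _ :=
      hq.hom_ext (fun a ↦ congr(($(hFA a)).fst)) (fun m ↦ congr(($(hFN m)).fst))
    exact congr($this z)
  have hmul (x y : R) : (F (x * y)).snd = x • (F y).snd + y • (F x).snd := by
    rw [map_mul, TrivSqZeroExt.snd_mul, hfst, hfst, op_smul_eq_smul]
  have hk (c : k) : (F (algebraMap k _ c)).snd = 0 := by
    rw [IsScalarTower.algebraMap_apply k A R, hFA]
    exact d.map_algebraMap c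
  refine ⟨Derivation.mk'
    { toFun z := (F z).snd
      map_add' x y := by rw [map_add, TrivSqZeroExt.snd_add]
      map_smul' c x := by
        rw [Algebra.smul_def, hmul, hk, smul_zero, add_zero, algebraMap_smul, RingHom.id_apply] }
    hmul, fun a ↦ congr(($(hFA a)).snd), fun m ↦ congr(($(hFN m)).snd)⟩

/-- If `m / l` and its differential vanish on a subscheme of the chart, then so do the coordinates
of `m`. -/
theorem IsChart.algebraMap_dual_mem (hq : IsChart l q) {J : Ideal R} {m : N} (hm : q m ∈ J)
    (hd : KaehlerDifferential.D k R (q m) ∈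
      J • (⊤ : Submodule R Ω[R⁄k])) (t : Module.Dual A N) :
    algebraMap A _ (t m) ∈ J := by
  -- A vertical derivation: d = 0 on A and e = t give D(q m) = t(m) - q(m) t(l), and the last term
  -- lies in J because q m does.
  obtain ⟨D, -, hD⟩ := hq.exists_derivation (k := k) (M := R) 0
    ((Algebra.linearMap A R) ∘ₗ t).toAddMonoidHom (fun a m ↦ by
      simp [Algebra.smul_def])
  have h1 := derivation_mem_smul_top D hd
  rw [smul_eq_mul, Ideal.mul_top, hD] at h1
  simpa using J.add_mem h1 (J.mul_mem_right _ hm : q m * algebraMap A _ (t l) ∈ J)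

variable {n : ℕ} (b : Module.Basis (Fin n) A N)

theorem map_eq_sum_coord (q : N →ₗ[A] R) (m : N) : q m = ∑ j, b.coord j m • q (b j) := by
  conv_lhs => rw [← b.sum_repr m, map_sum]
  simp only [map_smul]
  rfl

theorem baseChange_sum_coord {M : Type u} [AddCommGroup M] [Module A M]
    (φ : Module.Dual A N →ₗ[A] M) : φ.baseChange R (∑ j, q (b j) ⊗ₜ[A] b.coord j) =
      ∑ j, q (b j) ⊗ₜ[A] φ (b.coord j) := by
  rw [map_sum]
  rfl

/-- If `m / l` and its differential vanish on a subscheme of the chart, then so does the composition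
of the tautological section with the differential of the coordinates of `m`. -/
theorem IsChart.baseChange_mem (hq : IsChart l q) {I : Ideal A} {m : N} (hI : ∀ t : Module.Dual A N, t m ∈ I)
    {J : Ideal R} (hm : q m ∈ J)
    (hd : KaehlerDifferential.D k R (q m) ∈
      J • (⊤ : Submodule R Ω[R⁄k])) :
    (dualToKaehler A k I m hI).baseChange R (∑ j, q (b j) ⊗ₜ[A] b.coord j) ∈
      J • (⊤ : Submodule R (R ⊗[A] ((A ⧸ I) ⊗[A] Ω[A⁄k]))) := by
  let d := ((TensorProduct.mk A R ((A ⧸ I) ⊗[A] Ω[A⁄k]) 1).comp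
    (TensorProduct.mk A (A ⧸ I) Ω[A⁄k] 1)).compDer (KaehlerDifferential.D k A)
  have hd' (a : A) : d a = 1 ⊗ₜ (1 ⊗ₜ KaehlerDifferential.D k A a) := rfl
  -- Differentiate the coordinates of m and keep the y_j/l constant. The value of `e` at the given
  -- section is exactly the tautological composition.
  let e : N →+ R ⊗[A] ((A ⧸ I) ⊗[A] Ω[A⁄k]) :=
    { toFun m := ∑ j, q (b j) ⊗ₜ (1 ⊗ₜ KaehlerDifferential.D k A (b.coord j m))
      map_zero' := by simp
      map_add' m m' := by simp only [map_add, TensorProduct.tmul_add, Finset.sum_add_distrib] }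
  have he' (m : N) : e m = ∑ j, q (b j) ⊗ₜ
    (1 ⊗ₜ KaehlerDifferential.D k A (b.coord j m)) := rfl
  have he (a : A) (m : N) : e (a • m) = a • e m + q m • d a := by
    rw [he', he', hd', map_eq_sum_coord b q m, Finset.smul_sum, Finset.sum_smul,
      ← Finset.sum_add_distrib]
    refine Finset.sum_congr rfl fun j _ ↦ ?_
    rw [map_smul, smul_eq_mul, Derivation.leibniz, TensorProduct.tmul_add, TensorProduct.tmul_add,
      TensorProduct.tmul_smul, TensorProduct.tmul_smul, TensorProduct.tmul_smul,
      TensorProduct.tmul_smul, smul_assoc]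
    congr 2
    rw [TensorProduct.smul_tmul', smul_eq_mul, mul_one]
  obtain ⟨D, -, hD⟩ := hq.exists_derivation d e he
  have h1 := derivation_mem_smul_top D hd
  rw [hD] at h1
  rw [baseChange_sum_coord]
  -- D(q m) is e m - q(m) e(l); since q m lies in J, the correction can be added back.
  have h2 := add_mem h1 (Submodule.smul_mem_smul hm (trivial : e l ∈ ⊤))
  rwa [sub_add_cancel] at h2

/-- The converse to `IsChart.baseChange_mem`. -/
theorem D_mem_of_baseChange_mem {I : Ideal A} {m : N} (hI : ∀ t : Module.Dual A N, t m ∈ I)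
    {J : Ideal R} (hIJ : I.map (algebraMap A R) ≤ J)
    (h : (dualToKaehler A k I m hI).baseChange R (∑ j, q (b j) ⊗ₜ[A] b.coord j) ∈
      J • (⊤ : Submodule R (R ⊗[A] ((A ⧸ I) ⊗[A] Ω[A⁄k])))) :
    KaehlerDifferential.D k R (q m) ∈
      J • (⊤ : Submodule R Ω[R⁄k]) := by
  set P := J • (⊤ : Submodule R Ω[R⁄k]) with hP
  -- Pullback of differentials, read modulo J Ω_R. There I acts as zero because it maps into J, so
  -- the map factors through (A/I) ⊗ Ω_A and extends R-linearly to ψ.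
  let ψ₀ : Ω[A⁄k] →ₗ[A] Ω[R⁄k] ⧸ P :=
    (P.mkQ.restrictScalars A).comp (KaehlerDifferential.map k k A R)
  have hψ₀ (a : A) (ha : a ∈ I) (x) : a • ψ₀ x = 0 := by
    rw [← algebraMap_smul R a]
    change _ • P.mkQ _ = 0
    rw [← map_smul, Submodule.mkQ_apply, Submodule.Quotient.mk_eq_zero]
    exact Submodule.smul_mem_smul (hIJ (Ideal.mem_map_of_mem _ ha)) trivial
  let ψ₁ : (A ⧸ I) →ₗ[A] Ω[A⁄k] →ₗ[A] Ω[R⁄k] ⧸ P :=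
    Submodule.liftQ I (LinearMap.toSpanSingleton A _ ψ₀) fun a ha ↦
      LinearMap.ext fun x ↦ hψ₀ a ha x
  let ψ := (TensorProduct.lift ψ₁).liftBaseChange R
  have hψ (r) (x : Ω[A⁄k]) : ψ (r ⊗ₜ (1 ⊗ₜ x)) =
      P.mkQ (r • KaehlerDifferential.map k k A R x) := by
    rw [LinearMap.liftBaseChange_tmul, TensorProduct.lift.tmul]
    change r • ((1 : A) • ψ₀ x) = _
    rw [one_smul, map_smul]
    rfl
  have h1 : ψ ((dualToKaehler A k I m hI).baseChange R (∑ j, q (b j) ⊗ₜ[A] b.coord j)) = 0 := by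
    have := Submodule.mem_map_of_mem (f := ψ) h
    rw [Submodule.map_smul''] at this
    -- The target of ψ is annihilated by J, so ψ kills the tautological composition; this says that
    -- Σ (y_j/l) df_j lies in J Ω_R.
    have h2 : J • (Submodule.map ψ ⊤) ≤ ⊥ := by
      refine Submodule.smul_le.mpr fun r hr y _ ↦ ?_
      obtain ⟨y, rfl⟩ := P.mkQ_surjective y
      rw [Submodule.mem_bot, ← map_smul, Submodule.mkQ_apply, Submodule.Quotient.mk_eq_zero]
      exact Submodule.smul_mem_smul hr trivial
    exact h2 this
  rw [baseChange_sum_coord, map_sum] at h1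
  have h3 (j : Fin n) : ψ (q (b j) ⊗ₜ[A] dualToKaehler A k I m hI (b.coord j)) =
      P.mkQ (q (b j) • KaehlerDifferential.D k _ (algebraMap A _ (b.coord j m))) := by
    rw [← KaehlerDifferential.map_D k k A R]
    exact hψ _ _
  simp only [h3] at h1
  rw [← map_sum, Submodule.mkQ_apply, Submodule.Quotient.mk_eq_zero] at h1
  rw [map_eq_sum_coord b q m, map_sum]
  simp only [Algebra.smul_def, Derivation.leibniz]
  rw [Finset.sum_add_distrib]
  -- The remaining terms f_j d(y_j/l) lie in J Ω_R because each f_j lies in I.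
  refine add_mem (sum_mem fun j _ ↦ ?_) h1
  exact Submodule.smul_mem_smul (hIJ (Ideal.mem_map_of_mem _ (hI _))) trivial

theorem mem_of_map_le (b : Module.Basis (Fin n) A N) {I : Ideal A} {m : N} (hI : ∀ t : Module.Dual A N, t m ∈ I)
    {J : Ideal R} (hIJ : I.map (algebraMap A R) ≤ J) :
    q m ∈ J := by
  rw [map_eq_sum_coord b q m]
  simp only [Algebra.smul_def]
  exact sum_mem fun j _ ↦ J.mul_mem_right _ (hIJ (Ideal.mem_map_of_mem _ (hI _)))

end ChartDerivation

/-! ### Covering Proj by the loci l ≠ 0 and comparing equations on overlaps -/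

section ChartRing

variable {A N : Type u} [CommRing A] [AddCommGroup N] [Module A N]

theorem irrelevant_le_span_range_iota :
    (HomogeneousIdeal.irrelevant (gr A N)).toIdeal ≤
      Ideal.span (Set.range (SymmetricAlgebra.ι A N)) := by
  have h : HomogeneousIdeal.irrelevant (gr A N) ≤
      (⟨Ideal.span (Set.range (SymmetricAlgebra.ι A N)), Ideal.homogeneous_span _ _ (by
        rintro _ ⟨l, rfl⟩
        exact ⟨1, iota_mem A N l⟩)⟩ : HomogeneousIdeal (gr A N)) := by
    rw [HomogeneousIdeal.irrelevant_le]
    intro d hd x hx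
    obtain ⟨d, rfl⟩ := Nat.exists_eq_succ_of_ne_zero hd.ne'
    change x ∈ LinearMap.range (SymmetricAlgebra.ι A N) ^ (d + 1) at hx
    change x ∈ Ideal.span (Set.range (SymmetricAlgebra.ι A N))
    rw [pow_succ] at hx
    induction hx using Submodule.mul_induction_on' with
    | mem_mul_mem m hm n hn =>
      exact Ideal.mul_mem_left _ _ (Ideal.subset_span hn)
    | add x _ y _ hx hy => exact add_mem hx hy
  exact h

theorem exists_mem_basicOpen_iota (y : Proj (gr A N)) :
    ∃ l : N, y ∈ Proj.basicOpen (gr A N) (SymmetricAlgebra.ι A N l) := by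
  have h := Proj.iSup_basicOpen_eq_top _ _ (irrelevant_le_span_range_iota (A := A) (N := N))
  rw [← TopologicalSpace.Opens.mem_iSup, h]
  trivial

variable {A' N' : Type u} [CommRing A'] [AddCommGroup N'] [Module A' N'] {σ : A' →+* A}
  {A'' N'' : Type u} [CommRing A''] [AddCommGroup N''] [Module A'' N''] {σ' : A'' →+* A}

/-- The ring homomorphism from the chart on which `l` does not vanish to a smaller chart of the base
change along `g`. -/
noncomputable def chartRingMap (g : N' →ₛₗ[σ] N) (l : N') {b x : SymmetricAlgebra A N}
    (hb : b ∈ gr A N 1) (hx : x = SymmetricAlgebra.ι A N (g l) * b) :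
    ChartRing A' N' l →+* HomogeneousLocalization.Away (gr A N) x :=
  (HomogeneousLocalization.awayMap (gr A N) hb
    (hx.trans (by rw [grMap_apply, symMap_iota]) :
      x = grMap g (SymmetricAlgebra.ι A' N' l) * b)).comp
  (HomogeneousLocalization.Away.map (grMap g) (SymmetricAlgebra.ι A' N' l))

theorem val_chartRingMap_quot (g : N' →ₛₗ[σ] N) (l m : N') {b x : SymmetricAlgebra A N}
    (hb : b ∈ gr A N 1) (hx : x = SymmetricAlgebra.ι A N (g l) * b) :
    (chartRingMap g l hb hx (quot A' l m)).val =
      Localization.mk (SymmetricAlgebra.ι A N (g m) * b) ⟨x, Submonoid.mem_powers x⟩ := by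
  rw [chartRingMap, RingHom.comp_apply, quot, HomogeneousLocalization.Away.map_mk,
    HomogeneousLocalization.awayMap_mk, HomogeneousLocalization.Away.val_mk]
  simp only [grMap_apply, symMap_iota, pow_one]

theorem chartRingMap_quot_dvd (g : N' →ₛₗ[σ] N) (g' : N'' →ₛₗ[σ'] N) (l m : N') (l' m' : N'')
    (h : g m = g' m') {x : SymmetricAlgebra A N}
    (hx : x = SymmetricAlgebra.ι A N (g l) * SymmetricAlgebra.ι A N (g' l'))
    (hx' : x = SymmetricAlgebra.ι A N (g' l') * SymmetricAlgebra.ι A N (g l)) :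
    chartRingMap g' l' (iota_mem A N (g l)) hx' (quot A'' l' m') ∣
      chartRingMap g l (iota_mem A N (g' l')) hx (quot A' l m) := by
  have hm : SymmetricAlgebra.ι A N (g' l') * SymmetricAlgebra.ι A N (g' l') ∈ gr A N (1 • 2) :=
    SetLike.mul_mem_graded (iota_mem A N _) (iota_mem A N _)
  have hx2 : x ∈ gr A N 2 := hx ▸ SetLike.mul_mem_graded (iota_mem A N _) (iota_mem A N _)
  -- The quotient is l'/l, written with the denominator x = l l' of degree 2 as l'^2/(l l'): indeed
  -- m/l = (m/l')(l'/l).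
  refine ⟨HomogeneousLocalization.Away.mk (gr A N) hx2 1 _ hm, ?_⟩
  apply HomogeneousLocalization.val_injective
  rw [HomogeneousLocalization.val_mul, val_chartRingMap_quot, val_chartRingMap_quot,
    HomogeneousLocalization.Away.val_mk, Localization.mk_mul, Localization.mk_eq_mk_iff,
    Localization.r_iff_exists]
  refine ⟨1, ?_⟩
  simp only [OneMemClass.coe_one, one_mul, Submonoid.coe_mul, pow_one, h]
  rw [hx]
  ring

end ChartRing

/-! ### Charts of the projective bundle and their overlaps -/

namespace VectorBundle

variable {V : Scheme.{u}} {n : ℕ} (E : VectorBundle V n)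

/-- The inclusion of the part of the projective bundle over `U`. -/
noncomputable def projι (U : E.Patch) : Proj (gr Γ(V, U.opens) Γ(E.sheaf, U.opens)) ⟶ E.proj :=
  E.gluingData.cover.f U

instance (U : E.Patch) : IsOpenImmersion (E.projι U) :=
  E.gluingData.cover.map_prop U

theorem chart_eq (U : E.Patch) (l : Γ(E.sheaf, U.opens)) :
    E.chart U l = Proj.awayι (gr Γ(V, U.opens) Γ(E.sheaf, U.opens)) _ (iota_mem _ _ l) one_pos ≫
      E.projι U := rfl

instance (U : E.Patch) (l : Γ(E.sheaf, U.opens)) : IsOpenImmersion (E.chart U l) := by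
  rw [chart_eq]
  infer_instance

theorem projι_π (U : E.Patch) : E.projι U ≫ E.π =
    projToSpec Γ(V, U.opens) Γ(E.sheaf, U.opens) ≫ U.1.2.fromSpec := by
  rw [← IsAffineOpen.isoSpec_inv_ι, ← Category.assoc]
  exact E.gluingData.ι_toBase U

theorem coe_opensRange_awayι {A N : Type u} [CommRing A] [AddCommGroup N] [Module A N] {d : ℕ}
    (hd : 0 < d) (a : SymmetricAlgebra A N) (ha : a ∈ gr A N d) :
    Set.range (Proj.awayι (gr A N) a ha hd) = (Proj.basicOpen (gr A N) a : Set (Proj (gr A N))) :=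
  congr($(Proj.opensRange_awayι (gr A N) a ha hd).1)

theorem exists_mem_range_chart (y : E.proj) :
    ∃ c : Σ U : E.Patch, Γ(E.sheaf, U.opens), y ∈ Set.range (E.chart c.1 c.2) := by
  obtain ⟨U, z, rfl⟩ : ∃ (U : E.Patch), y ∈ Set.range (E.projι U) :=
    ⟨_, E.gluingData.cover.covers y⟩
  obtain ⟨l, hl⟩ := exists_mem_basicOpen_iota (A := Γ(V, U.opens)) (N := Γ(E.sheaf, U.opens)) z
  obtain ⟨w, rfl⟩ := (coe_opensRange_awayι one_pos _ (iota_mem _ _ l)).ge hl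
  exact ⟨⟨U, l⟩, w, rfl⟩

theorem chart_π (U : E.Patch) (l : Γ(E.sheaf, U.opens)) :
    E.chart U l ≫ E.π = Spec.map (CommRingCat.ofHom (toAway Γ(V, U.opens) Γ(E.sheaf, U.opens)
      (SymmetricAlgebra.ι Γ(V, U.opens) _ l))) ≫ U.1.2.fromSpec := by
  rw [chart_eq, Category.assoc, projι_π, ← Category.assoc, awayι_projToSpec]

variable {E} in
/-- The inclusion of the part of the projective bundle over a smaller patch. -/
noncomputable abbrev projRes {U T : E.Patch} (h : T ≤ U) :
    Proj (gr Γ(V, T.opens) Γ(E.sheaf, T.opens)) ⟶ Proj (gr Γ(V, U.opens) Γ(E.sheaf, U.opens)) :=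
  Proj.map (grMap (res E.sheaf (Patch.le h))) (irrelevant_le _ (Patch.span_res h))

theorem projRes_projι {U T : E.Patch} (h : T ≤ U) : projRes h ≫ E.projι U = E.projι T :=
  E.gluingData.cover.trans_map (show (show E.gluingData.cover.I₀ from T) ⟶ U from
    homOfLE (X := E.Patch) h)

/-- Over a smaller patch T, the locus l b ≠ 0 lies in the chart of l over U. For b = l' it serves as
an overlap of two charts. -/
theorem awayι_comp_projι {U T : E.Patch} (h : T ≤ U) (l : Γ(E.sheaf, U.opens))
    {b x : SymmetricAlgebra Γ(V, T.opens) Γ(E.sheaf, T.opens)} (hb : b ∈ gr _ _ 1)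
    (hx : x = SymmetricAlgebra.ι _ _ (res E.sheaf (Patch.le h) l) * b)
    (hx2 : x ∈ gr Γ(V, T.opens) Γ(E.sheaf, T.opens) (1 + 1)) :
    Proj.awayι (gr Γ(V, T.opens) Γ(E.sheaf, T.opens)) x hx2 two_pos ≫ E.projι T =
      Spec.map (CommRingCat.ofHom (chartRingMap (res E.sheaf (Patch.le h)) l hb hx)) ≫
        E.chart U l := by
  have hx' : x = grMap (res E.sheaf (Patch.le h)) (SymmetricAlgebra.ι _ _ l) * b := by
    rw [hx, grMap_apply, symMap_iota]
  rw [← E.projRes_projι h, ← Category.assoc, chart_eq, ← Category.assoc]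
  congr 1
  rw [chartRingMap, CommRingCat.ofHom_comp, Spec.map_comp, Category.assoc,
    ← Proj.awayι_comp_map (grMap (res E.sheaf (Patch.le h)))
      (irrelevant_le _ (Patch.span_res h)) one_pos _ (iota_mem _ _ l), ← Category.assoc,
    Proj.SpecMap_awayMap_awayι]

/-- The patches form a locally directed cover, so a point over U and U' comes from Proj over some T
below both; neither l nor l' vanishes at it, hence neither does l l'. -/
theorem exists_common_chart (U U' : E.Patch) (l : Γ(E.sheaf, U.opens)) (l' : Γ(E.sheaf, U'.opens))
    {y : E.proj} (hy : y ∈ Set.range (E.chart U l)) (hy' : y ∈ Set.range (E.chart U' l')) :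
    ∃ (T : E.Patch) (h : T ≤ U) (h' : T ≤ U'),
      y ∈ Set.range (Proj.awayι (gr Γ(V, T.opens) Γ(E.sheaf, T.opens))
        (SymmetricAlgebra.ι _ _ (res E.sheaf (Patch.le h) l) *
          SymmetricAlgebra.ι _ _ (res E.sheaf (Patch.le h') l'))
        (SetLike.mul_mem_graded (iota_mem _ _ _) (iota_mem _ _ _)) two_pos ≫
          E.projι T) := by
  obtain ⟨z, rfl⟩ := hy
  obtain ⟨z', hz'⟩ := hy'
  obtain ⟨T, h, h', w, hw, hw'⟩ := E.gluingData.cover.exists_of_f_eq_f (i := U) (j := U')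
    (Proj.awayι (gr Γ(V, U.opens) Γ(E.sheaf, U.opens)) _ (iota_mem _ _ l) one_pos z)
    (Proj.awayι (gr Γ(V, U'.opens) Γ(E.sheaf, U'.opens)) _ (iota_mem _ _ l') one_pos z') hz'.symm
  change E.Patch at T
  replace h : T ≤ U := leOfHom (X := E.Patch) h
  replace h' : T ≤ U' := leOfHom (X := E.Patch) h'
  replace hw : projRes h w = _ := hw
  replace hw' : projRes h' w = _ := hw'
  refine ⟨T, h, h', ?_⟩
  rw [Scheme.Hom.comp_base, TopCat.coe_comp, Set.range_comp, coe_opensRange_awayι,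
    Proj.basicOpen_mul, TopologicalSpace.Opens.coe_inf]
  refine ⟨w, ⟨?_, ?_⟩, ?_⟩
  · rw [← symMap_iota]
    change projRes h w ∈ Proj.basicOpen _ _
    rw [hw]
    exact (coe_opensRange_awayι one_pos _ (iota_mem _ _ l)).le ⟨z, rfl⟩
  · rw [← symMap_iota]
    change projRes h' w ∈ Proj.basicOpen _ _
    rw [hw']
    exact (coe_opensRange_awayι one_pos _ (iota_mem _ _ l')).le ⟨z', rfl⟩
  · rw [chart_eq, Scheme.Hom.comp_apply, ← hw, ← E.projRes_projι h]
    exact Scheme.Hom.comp_apply _ _ _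

end VectorBundle

/-! ### Closed subschemes from compatible equations on charts -/

section LocalEquations

variable {Y : Scheme.{u}}

theorem germ_chartHom_dvd {R R' S : CommRingCat.{u}} {c : Spec R ⟶ Y} [IsOpenImmersion c]
    {c' : Spec R' ⟶ Y} [IsOpenImmersion c'] {d : Spec S ⟶ Y} [IsOpenImmersion d] {φ : R ⟶ S}
    {φ' : R' ⟶ S} (h : d = Spec.map φ ≫ c) (h' : d = Spec.map φ' ≫ c') {r : R} {r' : R'}
    (hr : φ r ∣ φ' r') {y : Y} (hy : y ∈ c ''ᵁ ⊤) (hy' : y ∈ c' ''ᵁ ⊤) (hd : y ∈ Set.range d) :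
    Y.presheaf.germ _ y hy (chartHom c r) ∣ Y.presheaf.germ _ y hy' (chartHom c' r') := by
  have hd' : y ∈ d ''ᵁ ⊤ := by
    obtain ⟨w, hw⟩ := hd
    exact ⟨w, trivial, hw⟩
  rw [← germ_resHom (chartOpen_le _ _ _ h) hd', ← germ_resHom (chartOpen_le _ _ _ h') hd',
    resHom_chartHom _ _ _ h, resHom_chartHom _ _ _ h']
  exact map_dvd _ (map_dvd _ hr)

/-- Functions on the members of an affine cover which differ by units on overlaps are the local
equations of a closed subscheme. -/
theorem exists_onSpec_eq_span {ι : Type*} {R : ι → CommRingCat.{u}} (c : ∀ i, Spec (R i) ⟶ Y)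
    [∀ i, IsOpenImmersion (c i)] (hc : ∀ y, ∃ i, y ∈ Set.range (c i)) (r : ∀ i, R i)
    (h : ∀ i j, ∀ y ∈ Set.range (c i), y ∈ Set.range (c j) →
      ∃ (S : CommRingCat.{u}) (d : Spec S ⟶ Y) (_ : IsOpenImmersion d) (φ : R i ⟶ S) (ψ : R j ⟶ S),
        d = Spec.map φ ≫ c i ∧ d = Spec.map ψ ≫ c j ∧ y ∈ Set.range d ∧ φ (r i) ∣ ψ (r j)) :
    ∃ J : Y.IdealSheafData, ∀ i, onSpec J (c i) = Ideal.span {r i} := by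
  obtain ⟨J, hJ⟩ := exists_idealSheafData_of_germ_dvd (σ := fun i ↦ chartHom (c i) (r i))
    (fun i ↦ (chartOpen (c i)).2) (iSup_chartOpen c hc) (fun i j y hi hj ↦ by
      have ⟨z, _, hz⟩ := hi
      have ⟨w, _, hw⟩ := hj
      obtain ⟨S, d, _, φ, ψ, hφ, hψ, hy, hr⟩ := h i j y ⟨z, hz⟩ ⟨w, hw⟩
      exact germ_chartHom_dvd hφ hψ hr hi hj hy)
  refine ⟨J, fun i ↦ ?_⟩
  rw [onSpec_eq_comap, hJ i, ← Set.image_singleton, ← Ideal.map_span]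
  exact Ideal.comap_map_of_bijective _ (chartHom_bijective _)

end LocalEquations

/-! ### The equation of the hypersurface on each chart -/

namespace VectorBundle

variable {V : Scheme.{u}} {n : ℕ} (E : VectorBundle V n)

/-- The coordinate rings of the charts. -/
noncomputable def chartRing (c : Σ U : E.Patch, Γ(E.sheaf, U.opens)) : CommRingCat.{u} :=
  .of (ChartRing Γ(V, c.1.opens) Γ(E.sheaf, c.1.opens) c.2)

/-- The charts, as a family indexed by a single type. -/
noncomputable def charts (c : Σ U : E.Patch, Γ(E.sheaf, U.opens)) :
    Spec (E.chartRing c) ⟶ E.proj :=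
  E.chart c.1 c.2

instance (c : Σ U : E.Patch, Γ(E.sheaf, U.opens)) : IsOpenImmersion (E.charts c) :=
  inferInstanceAs (IsOpenImmersion (E.chart c.1 c.2))

/-- Divisibility in one direction is enough, because the statement covers every ordered pair of
charts. -/
theorem exists_chart_overlap (s : Γ(E.sheaf, ⊤)) (c c' : Σ U : E.Patch, Γ(E.sheaf, U.opens))
    (y : E.proj) (hy : y ∈ Set.range (E.charts c)) (hy' : y ∈ Set.range (E.charts c')) :
    ∃ (S : CommRingCat.{u}) (d : Spec S ⟶ E.proj) (_ : IsOpenImmersion d)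
      (φ : E.chartRing c ⟶ S) (ψ : E.chartRing c' ⟶ S),
      d = Spec.map φ ≫ E.charts c ∧ d = Spec.map ψ ≫ E.charts c' ∧ y ∈ Set.range d ∧
        φ (quot Γ(V, c.1.opens) c.2 (c.1.sec s)) ∣ ψ (quot Γ(V, c'.1.opens) c'.2 (c'.1.sec s)) := by
  obtain ⟨U, l⟩ := c
  obtain ⟨U', l'⟩ := c'
  obtain ⟨T, h, h', hT⟩ := E.exists_common_chart U U' l l' hy hy'
  exact ⟨_, _, inferInstance, _, _,
    E.awayι_comp_projι h l (iota_mem _ _ (res E.sheaf (Patch.le h') l')) rfl _,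
    E.awayι_comp_projι h' l' (iota_mem _ _ (res E.sheaf (Patch.le h) l)) (mul_comm _ _) _, hT,
    chartRingMap_quot_dvd _ _ _ _ _ _ ((res_res _ _ _ _).trans (res_res _ _ _ _).symm)
      (mul_comm _ _) rfl⟩

theorem onSpec_hypersurfaceIdeal (s : Γ(E.sheaf, ⊤)) (U : E.Patch) (l : Γ(E.sheaf, U.opens)) :
    onSpec (E.hypersurfaceIdeal s) (E.chart U l) =
      Ideal.span {quot Γ(V, U.opens) l (U.sec s)} := by
  obtain ⟨J, hJ⟩ := exists_onSpec_eq_span E.charts E.exists_mem_range_chart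
    (fun c ↦ quot Γ(V, c.1.opens) c.2 (c.1.sec s)) (E.exists_chart_overlap s)
  have hJ' (U : E.Patch) (l : Γ(E.sheaf, U.opens)) : onSpec J (E.chart U l) =
      Ideal.span {quot Γ(V, U.opens) l (U.sec s)} := hJ ⟨U, l⟩
  suffices h : E.hypersurfaceIdeal s = J by rw [h, hJ']
  -- The constructed J belongs to the set whose infimum is taken, and it is below every member
  -- because its charts' ideals are generated by the required functions; so it is the minimum.
  refine le_antisymm (sInf_le fun U l ↦ ?_) (le_sInf fun J' h ↦ ?_)
  · rw [hJ']
    exact Ideal.subset_span rfl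
  · refine (le_iff_onSpec_le E.charts E.exists_mem_range_chart).mpr fun c ↦ ?_
    rw [hJ c]
    exact (Ideal.span_singleton_le_iff_mem _).mpr (h _ _)

end VectorBundle

/-! ### The local implications with the k-structure induced from A -/

section ChartAlgebra

variable {A N R k : Type u} [CommRing A] [AddCommGroup N] [Module A N] [CommRing R] [Algebra A R]
  [CommRing k] [Algebra k A] {l : N} {q : N →ₗ[A] R} {n : ℕ} {m : N} {I : Ideal A} {J : Ideal R}

/-- The structure of `k`-algebra on an `A`-algebra. -/
abbrev algebraOver (k A R : Type u) [CommRing k] [CommRing A] [CommRing R] [Algebra A R]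
    [Algebra k A] : Algebra k R :=
  ((algebraMap A R).comp (algebraMap k A)).toAlgebra

theorem IsChart.map_le_and_baseChange_mem (hq : IsChart l q) (hI : ∀ t : Module.Dual A N, t m ∈ I)
    (hI' : ∀ a ∈ I, ∃ t : Module.Dual A N, t m = a) (hm : q m ∈ J)
    (hd : letI := algebraOver k A R
      KaehlerDifferential.D k R (q m) ∈ J • (⊤ : Submodule R Ω[R⁄k])) :
    I.map (algebraMap A R) ≤ J ∧ ∀ b : Module.Basis (Fin n) A N,
      (dualToKaehler A k I m hI).baseChange R (∑ j, q (b j) ⊗ₜ[A] b.coord j) ∈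
        J • (⊤ : Submodule R (R ⊗[A] ((A ⧸ I) ⊗[A] Ω[A⁄k]))) := by
  let := algebraOver k A R
  have : IsScalarTower k A R := .of_algebraMap_eq' rfl
  refine ⟨Ideal.map_le_iff_le_comap.mpr fun a ha ↦ ?_, fun b ↦ hq.baseChange_mem b hI hm hd⟩
  obtain ⟨t, rfl⟩ := hI' a ha
  exact hq.algebraMap_dual_mem hm hd t

theorem mem_and_D_mem_of_baseChange_mem (b : Module.Basis (Fin n) A N)
    (hI : ∀ t : Module.Dual A N, t m ∈ I) (hIJ : I.map (algebraMap A R) ≤ J)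
    (h : (dualToKaehler A k I m hI).baseChange R (∑ j, q (b j) ⊗ₜ[A] b.coord j) ∈
      J • (⊤ : Submodule R (R ⊗[A] ((A ⧸ I) ⊗[A] Ω[A⁄k])))) :
    letI := algebraOver k A R
    q m ∈ J ∧ ∀ f ∈ Ideal.span {q m},
      KaehlerDifferential.D k R f ∈ J • (⊤ : Submodule R Ω[R⁄k]) := by
  let := algebraOver k A R
  have : IsScalarTower k A R := .of_algebraMap_eq' rfl
  have hm : q m ∈ J := mem_of_map_le b hI hIJ
  have hd := D_mem_of_baseChange_mem b hI hIJ h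
  refine ⟨hm, fun f hf ↦ ?_⟩
  obtain ⟨a, rfl⟩ := Ideal.mem_span_singleton'.mp hf
  rw [Derivation.leibniz]
  exact add_mem (Submodule.smul_mem _ _ hd) (Submodule.smul_mem_smul hm trivial)

end ChartAlgebra

/-! ### Compatibility of the charts with the projection and the base field -/

namespace VectorBundle

variable {V : Scheme.{u}} {n : ℕ} (E : VectorBundle V n)

theorem fromSpec_comp {k : Type u} [CommRing k] (p : V ⟶ Spec (.of k)) {U : V.Opens}
    (hU : IsAffineOpen U) :
    letI := sectionsAlgebra p U
    hU.fromSpec ≫ p = Spec.map (CommRingCat.ofHom (algebraMap k Γ(V, U))) := by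
  have h := IsAffineOpen.SpecMap_appLE_fromSpec p (isAffineOpen_top (Spec (.of k))) hU le_top
  rw [← h, IsAffineOpen.fromSpec_top, Scheme.isoSpec_Spec_inv, ← Spec.map_comp]
  rfl

theorem chart_π_comp {k : Type u} [CommRing k] (p : V ⟶ Spec (.of k)) (U : E.Patch)
    (l : Γ(E.sheaf, U.opens)) :
    letI := sectionsAlgebra p U.opens
    letI := algebraOver k Γ(V, U.opens) (ChartRing Γ(V, U.opens) Γ(E.sheaf, U.opens) l)
    E.chart U l ≫ E.π ≫ p = Spec.map (CommRingCat.ofHom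
      (algebraMap k (ChartRing Γ(V, U.opens) Γ(E.sheaf, U.opens) l))) := by
  rw [← Category.assoc, chart_π, Category.assoc, fromSpec_comp, ← Spec.map_comp]
  rfl

theorem comap_π_le_iff (X : V.IdealSheafData) (J : E.proj.IdealSheafData) :
    X.comap E.π ≤ J ↔ ∀ (U : E.Patch) (l : Γ(E.sheaf, U.opens)),
      (X.ideal ⟨U.opens, U.1.2⟩).map (algebraMap Γ(V, U.opens)
        (ChartRing Γ(V, U.opens) Γ(E.sheaf, U.opens) l)) ≤ onSpec J (E.chart U l) := by
  have h (U : E.Patch) (l : Γ(E.sheaf, U.opens)) :=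
    comap_onSpec_le_iff _ _ _ _ (E.chart_π U l) X J
  simp only [onSpec_fromSpec] at h
  rw [le_iff_onSpec_le E.charts E.exists_mem_range_chart]
  exact ⟨fun h' U l ↦ (h U l).mp (h' ⟨U, l⟩), fun h' c ↦ (h c.1 c.2).mpr (h' c.1 c.2)⟩

end VectorBundle

/-- The k-structure of each chart ring is supplied as a ring homomorphism, since it varies with the
patch; choosing all of them at once gives the family of instances needed for `D_mem_of_onSpec`. -/
theorem D_mem_of_charts {k : Type u} [CommRing k] {Y : Scheme.{u}} (q : Y ⟶ Spec (.of k))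
    {I J : Y.IdealSheafData} {ι : Type*} {R : ι → CommRingCat.{u}} (c : ∀ i, Spec (R i) ⟶ Y)
    [∀ i, IsOpenImmersion (c i)] (hc : ∀ y, ∃ i, y ∈ Set.range (c i)) (hIJ : I ≤ J)
    (h : ∀ i, ∃ ρ : k →+* R i, c i ≫ q = Spec.map (CommRingCat.ofHom ρ) ∧
      ∀ f ∈ onSpec I (c i), letI := ρ.toAlgebra
        KaehlerDifferential.D k (R i) f ∈ onSpec J (c i) • (⊤ : Submodule (R i) Ω[R i⁄k]))
    (W : Y.affineOpens) (f : Γ(Y, W)) (hf : f ∈ I.ideal W) :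
    letI := sectionsAlgebra q W
    KaehlerDifferential.D k Γ(Y, W) f ∈ J.ideal W • (⊤ : Submodule Γ(Y, W) Ω[Γ(Y, W)⁄k]) := by
  choose ρ hρ hD using h
  let (i : ι) : Algebra k (R i) := (ρ i).toAlgebra
  exact D_mem_of_onSpec q c hc hρ hIJ hD W f hf

/-! ### Equality of the two ideal sheaves -/

namespace VectorBundle

variable {V : Scheme.{u}} {n : ℕ} (E : VectorBundle V n)

theorem hypersurfaceIdeal_le_iff (s : Γ(E.sheaf, ⊤)) (J : E.proj.IdealSheafData) :
    E.hypersurfaceIdeal s ≤ J ↔ ∀ (U : E.Patch) (l : Γ(E.sheaf, U.opens)),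
      quot Γ(V, U.opens) l (U.sec s) ∈ onSpec J (E.chart U l) := by
  rw [le_iff_onSpec_le E.charts E.exists_mem_range_chart]
  have h (U : E.Patch) (l : Γ(E.sheaf, U.opens)) :
      onSpec (E.hypersurfaceIdeal s) (E.chart U l) ≤ onSpec J (E.chart U l) ↔
        quot Γ(V, U.opens) l (U.sec s) ∈ onSpec J (E.chart U l) := by
    rw [onSpec_hypersurfaceIdeal, Ideal.span_singleton_le_iff_mem]
  exact ⟨fun h' U l ↦ (h U l).mp (h' ⟨U, l⟩), fun h' c ↦ (h c.1 c.2).mpr (h' c.1 c.2)⟩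

variable {E} {k : Type u} [CommRing k] (p : V ⟶ Spec (.of k)) {s : Γ(E.sheaf, ⊤)}
  {X : V.IdealSheafData} {J : E.proj.IdealSheafData}

theorem IsZeroScheme.mem_and_D_mem (hX : E.IsZeroScheme s X) (hXJ : X.comap E.π ≤ J) (U : E.Patch)
    (l : Γ(E.sheaf, U.opens)) (b : Module.Basis (Fin n) Γ(V, U.opens) Γ(E.sheaf, U.opens))
    (hJ : letI := sectionsAlgebra p U.opens
      (dualToKaehler Γ(V, U.opens) k (X.ideal ⟨U.opens, U.1.2⟩) (U.sec s)
        (hX.dual_mem U)).baseChange (ChartRing Γ(V, U.opens) Γ(E.sheaf, U.opens) l)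
          (taut Γ(V, U.opens) b l) ∈
        onSpec J (E.chart U l) • (⊤ : Submodule (ChartRing Γ(V, U.opens) Γ(E.sheaf, U.opens) l) _)) :
    letI := sectionsAlgebra p U.opens
    letI := algebraOver k Γ(V, U.opens) (ChartRing Γ(V, U.opens) Γ(E.sheaf, U.opens) l)
    quot Γ(V, U.opens) l (U.sec s) ∈ onSpec J (E.chart U l) ∧
      ∀ f ∈ onSpec (E.hypersurfaceIdeal s) (E.chart U l),
        KaehlerDifferential.D k (ChartRing Γ(V, U.opens) Γ(E.sheaf, U.opens) l) f ∈
          onSpec J (E.chart U l) • (⊤ : Submodule (ChartRing Γ(V, U.opens) Γ(E.sheaf, U.opens) l)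
            Ω[ChartRing Γ(V, U.opens) Γ(E.sheaf, U.opens) l⁄k]) := by
  let := sectionsAlgebra p U.opens
  have hI := (E.comap_π_le_iff X J).mp hXJ U l
  have h := mem_and_D_mem_of_baseChange_mem (q := quotLin l) b (hX.dual_mem U) hI hJ
  exact ⟨h.1, fun f hf ↦ h.2 f ((E.onSpec_hypersurfaceIdeal s U l).le hf)⟩

theorem IsZeroScheme.map_le_and_taut_mem (hX : E.IsZeroScheme s X) (hIJ : E.hypersurfaceIdeal s ≤ J)
    (hD : ∀ W : E.proj.affineOpens, ∀ f ∈ (E.hypersurfaceIdeal s).ideal W,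
      letI := sectionsAlgebra (E.π ≫ p) W
      KaehlerDifferential.D k Γ(E.proj, W) f ∈
        J.ideal W • (⊤ : Submodule Γ(E.proj, W) Ω[Γ(E.proj, W)⁄k]))
    (U : E.Patch) (l : Γ(E.sheaf, U.opens)) :
    letI := sectionsAlgebra p U.opens
    (X.ideal ⟨U.opens, U.1.2⟩).map (algebraMap Γ(V, U.opens)
        (ChartRing Γ(V, U.opens) Γ(E.sheaf, U.opens) l)) ≤ onSpec J (E.chart U l) ∧
      ∀ b : Module.Basis (Fin n) Γ(V, U.opens) Γ(E.sheaf, U.opens),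
        (dualToKaehler Γ(V, U.opens) k (X.ideal ⟨U.opens, U.1.2⟩) (U.sec s)
          (hX.dual_mem U)).baseChange (ChartRing Γ(V, U.opens) Γ(E.sheaf, U.opens) l)
            (taut Γ(V, U.opens) b l) ∈ onSpec J (E.chart U l) •
              (⊤ : Submodule (ChartRing Γ(V, U.opens) Γ(E.sheaf, U.opens) l) _) := by
  let := sectionsAlgebra p U.opens
  let := algebraOver k Γ(V, U.opens) (ChartRing Γ(V, U.opens) Γ(E.sheaf, U.opens) l)
  have hd := D_mem_onSpec (E.π ≫ p) (E.chart U l) (E.chart_π_comp p U l) hD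
    (f := quot Γ(V, U.opens) l (U.sec s)) (by
      rw [onSpec_hypersurfaceIdeal]
      exact Ideal.subset_span rfl)
  exact (isChart_quotLin l).map_le_and_baseChange_mem (hX.dual_mem U)
    (fun a ha ↦ by rwa [hX U] at ha) ((E.hypersurfaceIdeal_le_iff s J).mp hIJ U l) hd

theorem IsZeroScheme.tyurinaIdeal_eq_singularityIdeal (hX : E.IsZeroScheme s X) :
    E.tyurinaIdeal s p hX = singularityIdeal (E.π ≫ p) (E.hypersurfaceIdeal s) := by
  -- The two infima agree because they are taken over the same set of ideal sheaves J.
  refine congrArg sInf (Set.ext fun J ↦ ⟨fun ⟨hXJ, hJ⟩ ↦ ?_, fun ⟨hIJ, hD⟩ ↦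
    ⟨(E.comap_π_le_iff X J).mpr fun U l ↦ (hX.map_le_and_taut_mem p hIJ hD U l).1,
      fun U l ↦ (hX.map_le_and_taut_mem p hIJ hD U l).2⟩⟩)
  -- The condition is imposed for every basis, but one is enough in this direction; a frame of the
  -- patch supplies it.
  have key (U : E.Patch) (l : Γ(E.sheaf, U.opens)) :=
    hX.mem_and_D_mem p hXJ U l (U.2.choose_spec.basis le_rfl) (hJ U l _)
  have hIJ : E.hypersurfaceIdeal s ≤ J :=
    (E.hypersurfaceIdeal_le_iff s J).mpr fun U l ↦ (key U l).1
  refine ⟨hIJ, D_mem_of_charts (E.π ≫ p) E.charts E.exists_mem_range_chart hIJ fun c ↦ ?_⟩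
  let := sectionsAlgebra p c.1.opens
  exact ⟨(algebraMap Γ(V, c.1.opens) (ChartRing Γ(V, c.1.opens) Γ(E.sheaf, c.1.opens) c.2)).comp
    (algebraMap k Γ(V, c.1.opens)), E.chart_π_comp p c.1 c.2, (key c.1 c.2).2⟩

end VectorBundle

end ProjBundle

/-! ### The theorem -/

theorem mainTheorem9 {k : Type u} [Field k] [IsAlgClosed k] [CharZero k]
    {V : Scheme.{u}} (p : V ⟶ Spec (.of k))
    [IsSeparated p] [LocallyOfFiniteType p] [QuasiCompact p] [Smooth p]
    {r : ℕ} (E : ProjBundle.VectorBundle V (r + 1)) (s : Γ(E.sheaf, ⊤))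
    (X : V.IdealSheafData) (hX : E.IsZeroScheme s X) :
    E.tyurinaIdeal s p hX =
        ProjBundle.singularityIdeal (E.π ≫ p) (E.hypersurfaceIdeal s) ∧
      ∀ (U : E.Patch) (y : Fin (r + 1) → Γ(E.sheaf, U.opens)),
        ProjBundle.IsFrame E.sheaf U.opens y →
        ∀ f : Fin (r + 1) → Γ(V, U.opens), U.sec s = ∑ j, f j • y j →
        ∀ i, ProjBundle.onSpec (E.hypersurfaceIdeal s) (E.chart U (y i)) =
          Ideal.span {∑ j, f j • ProjBundle.quot Γ(V, U.opens) (y i) (y j)} := by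
  refine ⟨hX.tyurinaIdeal_eq_singularityIdeal p, fun U y _ f hf i ↦ ?_⟩
  rw [E.onSpec_hypersurfaceIdeal, hf]
  have h : ProjBundle.quot Γ(V, U.opens) (y i) (∑ j, f j • y j) =
      ∑ j, f j • ProjBundle.quot Γ(V, U.opens) (y i) (y j) := by
    refine (map_sum (ProjBundle.quotLin (y i)) _ _).trans (Finset.sum_congr rfl fun j _ ↦ ?_)
    exact map_smul (ProjBundle.quotLin (y i)) _ _
  rw [h]
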